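/- Let $n\ge 1$ be an integer, $\theta,\phi\in(0,\infty)$ and $p,q,r\in(0,\infty]$ (with $1/\infty=0$). Put $s=\frac{n}{p^{-1}n+\theta}$ and $t=\frac{n}{q^{-1}n+\phi}$, and for $a\in[1,\infty)$ let $a'\in(1,\infty]$ be the conjugate exponent, $\frac1a+\frac1{a'}=1$. Assume that (1) $\frac{\theta}{n}>\frac{1}{\min\{2,r\}}-\frac1p$ and $\frac{\phi}{n}>\frac{1}{\min\{2,r\}}-\frac1q$; (2) $r<s'$ whenever $s\ge1$; (3) $r<t'$ whenever $t\ge1$. Then there is a constant $C>0$, depending only on $n,p,q,r,\theta,\phi$, such that $$\left(\frac{\||x|^\theta f\|_{L^p(\mathbb{R}^n)}}{\|f\|_{L^r(\mathbb{R}^n)}}\right)^{\phi-n\left(\frac1r-\frac1q\right)}\left(\frac{\||\xi|^\phi\hat f\|_{L^q(\mathbb{R}^n)}}{\|\hat f\|_{L^r(\mathbb{R}^n)}}\right)^{\theta-n\left(\frac1r-\frac1p\right)}\ge C$$ for every $f:\mathbb{R}^n\to\mathbb{C}$, not almost everywhere zero, with $f\in L^r(\mathbb{R}^n)$ and $\hat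 f\in L^r(\mathbb{R}^n)$. Here $\|g\|_{L^a}=(\int|g|^a)^{1/a}$ also for $0<a<1$, the weighted norms in the numerators may be $+\infty$, and $\hat f$ is the Fourier transform $\hat f(\xi)=\int_{\mathbb{R}^n}e^{-ix\cdot\xi}f(x)\,dx$, extended in the sense of tempered distributions to functions $f$ that lie in $L^a(\mathbb{R}^n)$ for some $a\in[1,\infty]$; thus for $r\ge1$ it is defined on all of $L^r(\mathbb{R}^n)$, and for $r<1$, where functions in $L^r$ need not be locally integrable, $f$ is understood to lie in $L^1(\mathbb{R}^n)$ as well. -/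

import Mathlib

open MeasureTheory
open scoped ENNReal SchwartzMap

/-- The integral Fourier transform `ψ̂(ξ) = ∫ e^{-i x·ξ} ψ(x) dx` on `ℝⁿ`
(no `2π` in the exponent, no normalising factor). -/
noncomputable def fourierHat {n : ℕ} (ψ : EuclideanSpace ℝ (Fin n) → ℂ)
    (ξ : EuclideanSpace ℝ (Fin n)) : ℂ :=
  ∫ x, Complex.exp (-(Complex.I * ((inner ℝ x ξ : ℝ) : ℂ))) * ψ x

/-- `IsFourierTransform f g`: the function `f`, which lies in some `L^s(ℝⁿ)` with `1 ≤ s ≤ ∞`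
and hence is a tempered distribution, has as its (distributional) Fourier transform the
function `g`, that is `∫ f ψ̂ = ∫ g ψ` for all Schwartz functions `ψ`.

If `f ∈ L^r` with `r ≥ 1`, the first field holds automatically. If `f ∈ L^r` with `r < 1`, it
says that `f ∈ L¹`, so that `g` is almost everywhere the Fourier integral of `f`. -/
structure IsFourierTransform {n : ℕ} (f g : EuclideanSpace ℝ (Fin n) → ℂ) : Prop where
  exists_memLp : ∃ s : ℝ≥0∞, 1 ≤ s ∧ MemLp f s volume
  integrable_mul : ∀ ψ : 𝓢(EuclideanSpace ℝ (Fin n), ℂ), Integrable (fun ξ => g ξ * ψ ξ) volume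
  integral_eq : ∀ ψ : 𝓢(EuclideanSpace ℝ (Fin n), ℂ),
    ∫ x, f x * fourierHat (⇑ψ) x = ∫ ξ, g ξ * ψ ξ

/-- The exponent `n / (p⁻¹ n + θ)`, for `p ∈ (0, ∞]` and `θ > 0`, where `∞⁻¹ = 0`. -/
noncomputable def critExponent (n : ℕ) (p : ℝ≥0∞) (θ : ℝ) : ℝ≥0∞ :=
  ENNReal.ofReal ((n : ℝ) / (p⁻¹.toReal * n + θ))

/-!
Write `u = 1/r`, `σ = 1/s = 1/p + θ/n`, `τ = 1/t = 1/q + φ/n`. The hypotheses give `u < σ`, `1 - u < σ`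
and the same for `τ`, and the exponents in the theorem are `n (τ - u)` and `n (σ - u)`, both
positive. Two facts carry the proof.

*Weighted interpolation* (`exists_logNorm_le_weighted`). By Hölder's inequality on a ball and on
its complement, and an optimal choice of the radius, the norm `‖|x|^θ f‖_p` can take the place of
`‖f‖_s` in the log-convexity inequality between `L^s` and `L^a`, for every exponent strictly
between `s` and `a`.

*The Hausdorff–Young inequality* (`hausdorff_young`), with some constant, for functions
related by the distributional Fourier transform. Truncating `f` at a height that depends on the
level `t`, the transform is the sum of a function bounded by `t / 2` and a function in `L²`
controlled by Plancherel's theorem; the layer cake formula then gives the inequality, as in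
Marcinkiewicz interpolation. By Fourier inversion it holds with the roles of `f` and its
transform exchanged.

For `r > 2`, Hausdorff–Young bounds `‖f̂‖_r` by `‖f‖_{r'}`, which interpolates between `‖|x|^θ f‖_p`
and `‖f‖_r`. For `r < 2` one interpolates `‖f‖_r` between `‖|x|^θ f‖_p` and `‖f‖_{r'} ≤ C ‖f̂‖_r` (for
`r < 1`: and `‖f‖_∞`, itself bounded in terms of `‖f‖_r` and `‖f̂‖_r`). In both cases the weighted norm
of `f` bounds the ratio of `‖f‖_r` and `‖f̂‖_r` from one side, and by symmetry the weighted norm of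
`f̂` bounds it from the other; the ratio cancels in the product. For `r = 2` the ratio is constant
and carries no information, so the argument passes through `‖f‖_a` and `‖f̂‖_{a'}` for some `a < 2`
close to `2`.
-/

open scoped FourierTransform

/-! ### Functions related by the distributional Fourier transform -/

section FourierPairs

variable {E : Type*} [NormedAddCommGroup E] [InnerProductSpace ℝ E] [FiniteDimensional ℝ E]
  [MeasurableSpace E] [BorelSpace E]

lemma locallyIntegrable_of_forall_schwartz {g : E → ℂ}
    (hg : ∀ ψ : 𝓢(E, ℂ), Integrable (fun x => g x * ψ x)) : LocallyIntegrable g := by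
  intro x
  let χ : ContDiffBump x := ⟨1, 2, one_pos, one_lt_two⟩
  have h1 : HasCompactSupport (fun y => (χ y : ℂ)) :=
    χ.hasCompactSupport.comp_left Complex.ofReal_zero
  have h2 : ContDiff ℝ (⊤ : ℕ∞) (fun y => (χ y : ℂ)) := Complex.ofRealCLM.contDiff.comp χ.contDiff
  refine ⟨Metric.closedBall x 1, Metric.closedBall_mem_nhds x one_pos, ?_⟩
  refine (hg (h1.toSchwartzMap h2)).integrableOn.congr_fun (fun y hy => ?_) measurableSet_closedBall
  have : χ y = 1 := χ.one_of_mem_closedBall hy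
  simp [this]

lemma ae_eq_of_forall_schwartz {g g' : E → ℂ} (hg : LocallyIntegrable g)
    (hg' : LocallyIntegrable g')
    (h : ∀ ψ : 𝓢(E, ℂ), ∫ x, g x * ψ x = ∫ x, g' x * ψ x) : g =ᵐ[volume] g' := by
  refine ae_eq_of_integral_contDiff_smul_eq hg hg' fun χ hχ hχc => ?_
  have h1 : HasCompactSupport (fun x => (χ x : ℂ)) := hχc.comp_left Complex.ofReal_zero
  have h2 : ContDiff ℝ (⊤ : ℕ∞) (fun x => (χ x : ℂ)) := Complex.ofRealCLM.contDiff.comp hχ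
  have := h (h1.toSchwartzMap h2)
  simpa [mul_comm] using! this

lemma integrable_mul_schwartz {p : ℝ≥0∞} (hp : 1 ≤ p) {f : E → ℂ} (hf : MemLp f p)
    (ψ : 𝓢(E, ℂ)) : Integrable (fun x => f x * ψ x) := by
  have := ENNReal.HolderConjugate.conjExponent hp
  rw [← memLp_one_iff_integrable]
  exact MemLp.mul (r := 1) (ψ.memLp p.conjExponent) hf

lemma integral_mul_fourier_of_integrable {F : E → ℂ} (hF : Integrable F) (ψ : 𝓢(E, ℂ)) :
    ∫ x, F x * 𝓕 ψ x = ∫ x, 𝓕 F x * ψ x := by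
  have := VectorFourier.integral_bilin_fourierIntegral_eq_flip (μ := volume) (ν := volume)
    (L := innerₗ E) (f := F) (g := ψ) (.mul ℂ ℂ) Real.continuous_fourierChar continuous_inner hF
    ψ.integrable
  simp only [ContinuousLinearMap.mul_apply', flip_innerₗ] at this
  rw [SchwartzMap.fourier_coe]
  exact this.symm

lemma integral_mul_fourier_of_memLp_two {F : E → ℂ} (hF : MemLp F 2) (ψ : 𝓢(E, ℂ)) :
    ∫ x, F x * 𝓕 ψ x = ∫ x, (𝓕 (hF.toLp F) : Lp ℂ 2 (volume : Measure E)) x * ψ x := by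
  have := congrArg (fun T => T ψ) (Lp.fourier_toTemperedDistribution_eq (hF.toLp F))
  simp only [TemperedDistribution.fourier_apply, Lp.toTemperedDistribution_apply, smul_eq_mul]
    at this
  simp_rw [mul_comm _ (ψ _)]
  rw [← this]
  refine integral_congr_ae ?_
  filter_upwards [hF.coeFn_toLp] with x hx
  rw [hx, mul_comm]

/-- The Fourier transform of a function in `L¹ + L²` is the sum of a function bounded by the
`L¹` norm and of a function with the same `L²` norm (Plancherel). -/
lemma exists_ae_eq_add_of_fourier_pair {F g : E → ℂ} (hg : LocallyIntegrable g)
    (hFg : ∀ ψ : 𝓢(E, ℂ), ∫ x, F x * 𝓕 ψ x = ∫ x, g x * ψ x) {F₁ F₂ : E → ℂ}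
    (hF : F = F₁ + F₂) (h₁ : MemLp F₁ 1) (h₂ : MemLp F₂ 2) :
    ∃ g₁ g₂ : E → ℂ, g =ᵐ[volume] g₁ + g₂ ∧ (∀ x, ‖g₁ x‖ₑ ≤ eLpNorm F₁ 1) ∧
      AEStronglyMeasurable g₁ ∧ AEStronglyMeasurable g₂ ∧ eLpNorm g₂ 2 = eLpNorm F₂ 2 := by
  have hi₁ : Integrable F₁ := memLp_one_iff_integrable.1 h₁
  have hc : Continuous (𝓕 F₁) := 
    VectorFourier.fourierIntegral_continuous Real.continuous_fourierChar continuous_inner hi₁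
  set g₂ : Lp ℂ 2 (volume : Measure E) := 𝓕 (h₂.toLp F₂) with hg₂
  have hm₂ : MemLp g₂ 2 := Lp.memLp g₂
  have hb : ∀ x, ‖𝓕 F₁ x‖ₑ ≤ eLpNorm F₁ 1 := fun x => by
    rw [eLpNorm_one_eq_lintegral_enorm, Real.fourier_eq]
    refine (enorm_integral_le_lintegral_enorm _).trans (le_of_eq ?_)
    exact lintegral_congr fun v => by rw [← ofReal_norm, Circle.norm_smul, ofReal_norm]
  have hbt : MemLp (𝓕 F₁) ∞ := ⟨hc.aestronglyMeasurable,
    (eLpNormEssSup_le_of_ae_enorm_bound (.of_forall hb)).trans_lt h₁.eLpNorm_lt_top⟩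
  refine ⟨𝓕 F₁, g₂, ?_, hb, hc.aestronglyMeasurable, hm₂.1, ?_⟩
  · refine ae_eq_of_forall_schwartz hg
      ((hc.locallyIntegrable).add (hm₂.locallyIntegrable (by norm_num))) fun ψ => ?_
    rw [← hFg, hF]
    simp only [Pi.add_apply, add_mul]
    rw [integral_add (integrable_mul_schwartz le_rfl h₁ _)
      (integrable_mul_schwartz (by norm_num) h₂ _),
      integral_add (integrable_mul_schwartz le_top hbt _)
      (integrable_mul_schwartz (by norm_num) hm₂ _), integral_mul_fourier_of_integrable hi₁,
      integral_mul_fourier_of_memLp_two h₂]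
  · have h := Lp.norm_fourier_eq (h₂.toLp F₂)
    rw [← hg₂, Lp.norm_def, Lp.norm_toLp,
      ENNReal.toReal_eq_toReal_iff' hm₂.eLpNorm_ne_top h₂.eLpNorm_ne_top] at h
    exact h

end FourierPairs

/-! ### The Hausdorff–Young inequality -/

section LevelSets

variable {E : Type*} [NormedAddCommGroup E] [InnerProductSpace ℝ E] [FiniteDimensional ℝ E]
  [MeasurableSpace E] [BorelSpace E]

/-- Weak-type estimate for the transform `g` of `F ∈ L^a`, with `m = ∫ |F|^a`: the part of `F` where
`t |F|^(a-1) > 2m` has `L¹` norm at most `t / 2`, so it does not contribute to `{|g| > t}` alone, and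
Plancherel's theorem controls the contribution of the rest. -/
lemma measure_lt_norm_le_of_fourier_pair {a m t : ℝ} (ha : 1 < a) (ha2 : a < 2) (hm : 0 < m)
    (ht : 0 < t) {F g : E → ℂ} (hF : StronglyMeasurable F)
    (hFm : ∫⁻ x, ‖F x‖ₑ ^ a = ENNReal.ofReal m) (hg : LocallyIntegrable g)
    (hFg : ∀ ψ : 𝓢(E, ℂ), ∫ x, F x * 𝓕 ψ x = ∫ x, g x * ψ x) :
    volume {x | t < ‖g x‖} ≤ ENNReal.ofReal (4 / t ^ 2) *
      ∫⁻ x, {x | t * ‖F x‖ ^ (a - 1) ≤ 2 * m}.indicator (fun x => ‖F x‖ₑ ^ (2 : ℝ)) x := by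
  set S : Set E := {x | t * ‖F x‖ ^ (a - 1) ≤ 2 * m} with hS
  have hSm : MeasurableSet S :=
    measurableSet_le ((hF.norm.measurable.pow_const _).const_mul _) measurable_const
  have hpow : ∀ y : ℝ, 0 ≤ y → y ^ a = y ^ (a - 1) * y := fun y hy => by
    rw [← Real.rpow_add_one' hy (by linarith)]; congr 1; ring
  -- off `S`, `|F| ≤ (t / (2m)) |F|^a`
  have h₁ : eLpNorm (Sᶜ.indicator F) 1 ≤ ENNReal.ofReal (t / 2) := by
    rw [eLpNorm_one_eq_lintegral_enorm]
    calc ∫⁻ x, ‖Sᶜ.indicator F x‖ₑ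
        ≤ ∫⁻ x, ENNReal.ofReal (t / (2 * m)) * ‖F x‖ₑ ^ a := by
          refine lintegral_mono fun x => ?_
          by_cases hx : x ∈ S
          · simp [hx]
          · have hx' : 2 * m < t * ‖F x‖ ^ (a - 1) := by simpa [hS] using hx
            rw [Set.indicator_of_mem (by simpa using hx), ← ofReal_norm,
              ENNReal.ofReal_rpow_of_nonneg (norm_nonneg _) (by linarith),
              ← ENNReal.ofReal_mul (by positivity)]
            refine ENNReal.ofReal_le_ofReal ?_
            rw [hpow _ (norm_nonneg _), div_mul_eq_mul_div, le_div_iff₀ (by positivity)]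
            nlinarith [norm_nonneg (F x)]
      _ = ENNReal.ofReal (t / 2) := by
          rw [lintegral_const_mul' _ _ ENNReal.ofReal_ne_top, hFm,
            ← ENNReal.ofReal_mul (by positivity)]
          congr 1; field_simp
  have h₂e : eLpNorm (S.indicator F) 2 ^ (2 : ℝ) =
      ∫⁻ x, S.indicator (fun x => ‖F x‖ₑ ^ (2 : ℝ)) x := by
    have := eLpNorm_nnreal_pow_eq_lintegral (μ := volume) (f := S.indicator F) (p := 2) two_ne_zero
    simp only [NNReal.coe_ofNat, ENNReal.coe_ofNat] at this
    rw [this]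
    refine lintegral_congr fun x => ?_
    by_cases hx : x ∈ S <;> simp [hx]
  -- on `S`, `F` is bounded, so `|F|²` is at most a multiple of `|F|^a`
  have h₂ : eLpNorm (S.indicator F) 2 < ∞ := by
    rw [← ENNReal.rpow_lt_top_iff_of_pos (y := 2) two_pos, h₂e]
    calc ∫⁻ x, S.indicator (fun x => ‖F x‖ₑ ^ (2 : ℝ)) x
        ≤ ∫⁻ x, ENNReal.ofReal (((2 * m / t) ^ (1 / (a - 1))) ^ (2 - a)) * ‖F x‖ₑ ^ a := by
          refine lintegral_mono fun x => ?_
          by_cases hx : x ∈ S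
          · have hx' : t * ‖F x‖ ^ (a - 1) ≤ 2 * m := hx
            have hle : ‖F x‖ ≤ (2 * m / t) ^ (1 / (a - 1)) := by
              have h := Real.rpow_le_rpow (z := 1 / (a - 1)) (by positivity)
                ((le_div_iff₀' ht).2 hx') (one_div_nonneg.2 (by linarith))
              rwa [← Real.rpow_mul (norm_nonneg _), mul_one_div_cancel (by linarith),
                Real.rpow_one] at h
            rw [Set.indicator_of_mem hx, ← ofReal_norm,
              ENNReal.ofReal_rpow_of_nonneg (norm_nonneg _) (by linarith),
              ENNReal.ofReal_rpow_of_nonneg (norm_nonneg _) (by linarith),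
              ← ENNReal.ofReal_mul (by positivity)]
            refine ENNReal.ofReal_le_ofReal ?_
            calc ‖F x‖ ^ (2 : ℝ) = ‖F x‖ ^ (2 - a) * ‖F x‖ ^ a := by
                  rw [← Real.rpow_add' (norm_nonneg _) (by norm_num)]; congr 1; ring
              _ ≤ _ := by gcongr
          · simp [hx]
      _ < ∞ := by
          rw [lintegral_const_mul' _ _ ENNReal.ofReal_ne_top, hFm]
          exact ENNReal.mul_lt_top ENNReal.ofReal_lt_top ENNReal.ofReal_lt_top
  obtain ⟨g₁, g₂, hgg, hg₁, -, hg₂m, hg₂⟩ := exists_ae_eq_add_of_fourier_pair hg hFg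
    (F₁ := Sᶜ.indicator F) (F₂ := S.indicator F) (S.indicator_compl_add_self F).symm
    ⟨(hF.indicator hSm.compl).aestronglyMeasurable, h₁.trans_lt ENNReal.ofReal_lt_top⟩
    ⟨(hF.indicator hSm).aestronglyMeasurable, h₂⟩
  have hsub : volume {x | t < ‖g x‖} ≤ volume {x | ENNReal.ofReal (t / 2) ≤ ‖g₂ x‖ₑ} := by
    refine measure_mono_ae ?_
    filter_upwards [hgg] with x hx (hxt : t < ‖g x‖)
    change ENNReal.ofReal (t / 2) ≤ ‖g₂ x‖ₑ
    have h3 : ‖g₁ x‖ ≤ t / 2 := by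
      have := (hg₁ x).trans h₁
      rwa [← ofReal_norm, ENNReal.ofReal_le_ofReal_iff (by positivity)] at this
    rw [hx, Pi.add_apply] at hxt
    rw [← ofReal_norm]
    refine ENNReal.ofReal_le_ofReal ?_
    linarith [norm_add_le (g₁ x) (g₂ x)]
  refine hsub.trans ((meas_ge_le_mul_pow_eLpNorm_enorm volume two_ne_zero ENNReal.ofNat_ne_top
    hg₂m (by simpa using ht) (by simp)).trans (le_of_eq ?_))
  rw [hg₂, ← h₂e, ENNReal.toReal_ofNat, ← ENNReal.ofReal_inv_of_pos (by positivity),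
    ENNReal.ofReal_rpow_of_nonneg (by positivity) (by norm_num)]
  congr 2
  rw [Real.rpow_two]; field_simp; norm_num

/-- The Hausdorff–Young inequality for `1 < a < 2`, by integrating
`measure_lt_norm_le_of_fourier_pair` over the levels `t`. -/
lemma lintegral_rpow_le_of_fourier_pair {a q m : ℝ} (ha : 1 < a) (ha2 : a < 2)
    (hq : q = a / (a - 1)) (hm : 0 < m) {F g : E → ℂ} (hF : StronglyMeasurable F)
    (hFm : ∫⁻ x, ‖F x‖ₑ ^ a = ENNReal.ofReal m) (hg : LocallyIntegrable g)
    (hFg : ∀ ψ : 𝓢(E, ℂ), ∫ x, F x * 𝓕 ψ x = ∫ x, g x * ψ x) :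
    ∫⁻ x, ‖g x‖ₑ ^ q ≤ ENNReal.ofReal (4 * q / (q - 2) * (2 * m) ^ (q - 2) * m) := by
  have ha0 : 0 < a - 1 := by linarith
  have hq2 : 2 < q := by rw [hq, lt_div_iff₀ ha0]; linarith
  have haq : (a - 1) * (q - 2) = 2 - a := by rw [hq]; field_simp; ring
  let k : ℝ → E → ℝ≥0∞ := fun t x => ENNReal.ofReal (4 * t ^ (q - 3)) *
    {x | t * ‖F x‖ ^ (a - 1) ≤ 2 * m}.indicator (fun x => ‖F x‖ₑ ^ (2 : ℝ)) x
  have hk : Measurable (Function.uncurry k) := by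
    have h : Measurable fun z : ℝ × E => {z : ℝ × E | z.1 * ‖F z.2‖ ^ (a - 1) ≤ 2 * m}.indicator
        (fun z => ‖F z.2‖ₑ ^ (2 : ℝ)) z := by
      have hF' := hF.measurable
      refine Measurable.indicator (by fun_prop) (measurableSet_le (by fun_prop) measurable_const)
    exact Measurable.mul (by fun_prop) h
  -- for fixed `x` the levels with `t |F x|^(a-1) ≤ 2m` form the interval `(0, T]`
  have hinner : ∀ x, ∫⁻ t in Set.Ioi 0, k t x ≤
      ENNReal.ofReal (4 / (q - 2) * (2 * m) ^ (q - 2)) * ‖F x‖ₑ ^ a := by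
    intro x
    by_cases hx : F x = 0
    · have : ∀ t, k t x = 0 := fun t => by
        simp [k, hx]
      simp [this]
    have hx0 : 0 < ‖F x‖ := norm_pos_iff.2 hx
    set T := 2 * m / ‖F x‖ ^ (a - 1) with hT
    have hT0 : 0 < T := by positivity
    have hii : IntervalIntegrable (fun t : ℝ => 4 * t ^ (q - 3)) volume 0 T :=
      (intervalIntegral.intervalIntegrable_rpow' (by linarith)).const_mul 4
    calc ∫⁻ t in Set.Ioi 0, k t x
        = ∫⁻ t in Set.Ioi 0, (Set.Iic T).indicator
            (fun t => ENNReal.ofReal (4 * t ^ (q - 3)) * ‖F x‖ₑ ^ (2 : ℝ)) t := by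
          refine lintegral_congr fun t => ?_
          by_cases ht : t ≤ T
          · have : t * ‖F x‖ ^ (a - 1) ≤ 2 * m := (le_div_iff₀ (by positivity)).1 ht
            simp [k, ht, this]
          · have : ¬ t * ‖F x‖ ^ (a - 1) ≤ 2 * m := fun h => ht ((le_div_iff₀ (by positivity)).2 h)
            simp [k, ht, this]
      _ = (∫⁻ t in Set.Ioc 0 T, ENNReal.ofReal (4 * t ^ (q - 3))) * ‖F x‖ₑ ^ (2 : ℝ) := by
          rw [lintegral_indicator measurableSet_Iic, Measure.restrict_restrict measurableSet_Iic,
            Set.inter_comm, Set.Ioi_inter_Iic, lintegral_mul_const _ (by fun_prop)]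
      _ = ENNReal.ofReal (4 * (T ^ (q - 2) / (q - 2))) * ‖F x‖ₑ ^ (2 : ℝ) := by
          rw [← ofReal_integral_eq_lintegral_ofReal
            ((intervalIntegrable_iff_integrableOn_Ioc_of_le hT0.le).1 hii), 
            ← intervalIntegral.integral_of_le hT0.le, intervalIntegral.integral_const_mul,
            integral_rpow (Or.inl (by linarith))]
          · rw [show q - 3 + 1 = q - 2 by ring, Real.zero_rpow (by linarith), sub_zero]
          · filter_upwards [ae_restrict_mem measurableSet_Ioc] with t ht
            have := ht.1
            positivity
      _ ≤ _ := by
          rw [← ofReal_norm,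
            ENNReal.ofReal_rpow_of_nonneg (norm_nonneg _) (by linarith),
            ENNReal.ofReal_rpow_of_nonneg (norm_nonneg _) (by linarith),
            ← ENNReal.ofReal_mul (by have := sub_pos.2 hq2; positivity),
            ← ENNReal.ofReal_mul (by have := sub_pos.2 hq2; positivity)]
          refine ENNReal.ofReal_le_ofReal (le_of_eq ?_)
          rw [hT, Real.div_rpow (by positivity) (by positivity), ← Real.rpow_mul hx0.le, haq]
          have : ‖F x‖ ^ (2 : ℝ) = ‖F x‖ ^ a * ‖F x‖ ^ (2 - a) := by
            rw [← Real.rpow_add hx0]; congr 1; ring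
          rw [this]
          have h0 : ‖F x‖ ^ (2 - a) ≠ 0 := by positivity
          field_simp
  have hgm : AEMeasurable (fun x => ‖g x‖) := hg.aestronglyMeasurable.norm.aemeasurable
  calc ∫⁻ x, ‖g x‖ₑ ^ q = ∫⁻ x, ENNReal.ofReal (‖g x‖ ^ q) := by
        refine lintegral_congr fun x => ?_
        rw [← ofReal_norm, ENNReal.ofReal_rpow_of_nonneg (norm_nonneg _) (by linarith)]
    _ = ENNReal.ofReal q * ∫⁻ t in Set.Ioi 0,
          volume {x | t < ‖g x‖} * ENNReal.ofReal (t ^ (q - 1)) :=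
        lintegral_rpow_eq_lintegral_meas_lt_mul _ (.of_forall fun x => norm_nonneg _) hgm
          (by linarith)
    _ ≤ ENNReal.ofReal q * ∫⁻ t in Set.Ioi 0, ∫⁻ x, k t x := by
        gcongr 1
        refine setLIntegral_mono_ae' measurableSet_Ioi (.of_forall fun t (ht : 0 < t) => ?_)
        rw [lintegral_const_mul' _ _ ENNReal.ofReal_ne_top]
        refine (mul_le_mul_left (measure_lt_norm_le_of_fourier_pair ha ha2 hm ht hF hFm hg hFg)
          _).trans (le_of_eq ?_)
        rw [mul_right_comm, ← ENNReal.ofReal_mul (by positivity)]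
        congr 2
        rw [show q - 1 = q - 3 + 2 by ring, Real.rpow_add ht, Real.rpow_two]
        field_simp
    _ = ENNReal.ofReal q * ∫⁻ x, ∫⁻ t in Set.Ioi 0, k t x := by
        rw [lintegral_lintegral_swap hk.aemeasurable]
    _ ≤ ENNReal.ofReal q * ∫⁻ x, ENNReal.ofReal (4 / (q - 2) * (2 * m) ^ (q - 2)) * ‖F x‖ₑ ^ a := by
        gcongr 2 with x
        exact hinner x
    _ = _ := by
        have := sub_pos.2 hq2
        rw [lintegral_const_mul' _ _ ENNReal.ofReal_ne_top, hFm, ← ENNReal.ofReal_mul (by positivity),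
          ← ENNReal.ofReal_mul (by linarith)]
        congr 1; ring

end LevelSets

/-- The exponent with reciprocal `u`; it is `∞` for `u = 0`. -/
noncomputable def recipExp (u : ℝ) : ℝ≥0∞ := (ENNReal.ofReal u)⁻¹

lemma recipExp_zero : recipExp 0 = ∞ := by simp [recipExp]

lemma recipExp_one : recipExp 1 = 1 := by simp [recipExp]

lemma recipExp_half : recipExp (1 / 2) = 2 := by
  rw [recipExp, ← ENNReal.ofReal_inv_of_pos (by norm_num)]; norm_num

lemma recipExp_of_pos {u : ℝ} (hu : 0 < u) : recipExp u = ENNReal.ofReal u⁻¹ :=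
  (ENNReal.ofReal_inv_of_pos hu).symm

lemma recipExp_ne_zero (u : ℝ) : recipExp u ≠ 0 := by simp [recipExp]

lemma recipExp_toReal {u : ℝ} (hu : 0 ≤ u) : (recipExp u).toReal = u⁻¹ := by
  simp [recipExp, ENNReal.toReal_inv, hu]

lemma recipExp_inv_toReal {p : ℝ≥0∞} (hp : 0 < p) : recipExp p⁻¹.toReal = p := by
  rw [recipExp, ENNReal.ofReal_toReal (by simpa using hp.ne'), inv_inv]

lemma one_le_recipExp {u : ℝ} (hu : u ≤ 1) : 1 ≤ recipExp u := by
  simpa [recipExp] using hu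

/-- The logarithm of `‖f‖_{L^{1/u}}`. The norms compared below are positive and finite, and in
logarithmic form the inequalities between products of their powers are linear. -/
noncomputable def logNorm {α : Type*} [MeasureSpace α] (u : ℝ) (f : α → ℂ) : ℝ :=
  Real.log (eLpNorm f (recipExp u) volume).toReal

section HausdorffYoung

variable {E : Type*} [NormedAddCommGroup E] [InnerProductSpace ℝ E] [FiniteDimensional ℝ E]
  [MeasurableSpace E] [BorelSpace E]

lemma eLpNorm_recipExp {v : ℝ} (hv : 0 < v) (f : E → ℂ) :
    eLpNorm f (recipExp v) volume = (∫⁻ x, ‖f x‖ₑ ^ v⁻¹) ^ v := by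
  rw [eLpNorm_eq_lintegral_rpow_enorm_toReal (recipExp_ne_zero v) (by simp [recipExp, hv]),
    recipExp_toReal hv.le, one_div, inv_inv]

lemma eLpNorm_le_of_fourier_pair_of_lt {v : ℝ} (hv : 1 / 2 < v) (hv1 : v < 1) {F g : E → ℂ}
    (hF : MemLp F (recipExp v)) (hg : LocallyIntegrable g)
    (hFg : ∀ ψ : 𝓢(E, ℂ), ∫ x, F x * 𝓕 ψ x = ∫ x, g x * ψ x) :
    eLpNorm g (recipExp (1 - v)) ≤
      ENNReal.ofReal (4 * (1 - v)⁻¹ / ((1 - v)⁻¹ - 2) * 2 ^ ((1 - v)⁻¹ - 2)) ^ (1 - v) *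
        eLpNorm F (recipExp v) := by
  have hv0 : 0 < v := by linarith
  have hv1' : 0 < 1 - v := by linarith
  obtain ⟨F', hF', hFF'⟩ := hF.1
  rw [eLpNorm_congr_ae hFF']
  have hF'm : MemLp F' (recipExp v) := (memLp_congr_ae hFF').1 hF
  have hFg' : ∀ ψ : 𝓢(E, ℂ), ∫ x, F' x * 𝓕 ψ x = ∫ x, g x * ψ x := fun ψ => by
    rw [← hFg]
    refine integral_congr_ae ?_
    filter_upwards [hFF'] with x hx
    rw [hx]
  have hfin : ∫⁻ x, ‖F' x‖ₑ ^ v⁻¹ < ∞ := by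
    rw [← ENNReal.rpow_lt_top_iff_of_pos hv0, ← eLpNorm_recipExp hv0]
    exact hF'm.2
  rw [eLpNorm_recipExp hv0, eLpNorm_recipExp hv1']
  rcases eq_or_ne (∫⁻ x, ‖F' x‖ₑ ^ v⁻¹) 0 with h0 | h0
  · have hF0 : F' =ᵐ[volume] 0 := by
      rw [lintegral_eq_zero_iff' (hF'.enorm.pow_const _).aemeasurable] at h0
      filter_upwards [h0] with x hx
      simpa [ENNReal.rpow_eq_zero_iff, hv0, hv0.not_gt] using hx
    have hg0 : g =ᵐ[volume] 0 := by
      refine ae_eq_of_forall_schwartz hg (locallyIntegrable_zero) fun ψ => ?_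
      rw [← hFg' ψ]
      refine integral_congr_ae ?_
      filter_upwards [hF0] with x hx
      simp [hx]
    have : ∫⁻ x, ‖g x‖ₑ ^ (1 - v)⁻¹ = 0 := by
      rw [← lintegral_zero (μ := (volume : Measure E))]
      refine lintegral_congr_ae ?_
      filter_upwards [hg0] with x hx
      simp [hx, hv1']
    simp [this, hv1']
  · set m := (∫⁻ x, ‖F' x‖ₑ ^ v⁻¹).toReal with hm
    have hm0 : 0 < m := ENNReal.toReal_pos h0 hfin.ne
    have hFm : ∫⁻ x, ‖F' x‖ₑ ^ v⁻¹ = ENNReal.ofReal m := (ENNReal.ofReal_toReal hfin.ne).symm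
    have hq2 : 0 < (1 - v)⁻¹ - 2 := by
      rw [sub_pos, lt_inv_comm₀ two_pos hv1']; linarith
    have := lintegral_rpow_le_of_fourier_pair (a := v⁻¹) (q := (1 - v)⁻¹)
      ((one_lt_inv₀ hv0).2 hv1) ((inv_lt_comm₀ hv0 two_pos).2 (by linarith))
      (by have : v⁻¹ - 1 = (1 - v) / v := by field_simp
          rw [this]; field_simp) hm0 hF' hFm hg hFg'
    refine (ENNReal.rpow_le_rpow this hv1'.le).trans (le_of_eq ?_)
    rw [hFm, ENNReal.ofReal_rpow_of_pos (by positivity), ENNReal.ofReal_rpow_of_pos hm0,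
      ENNReal.ofReal_rpow_of_pos (by positivity), ← ENNReal.ofReal_mul (by positivity)]
    congr 1
    have h1 : m ^ v = (m ^ ((1 - v)⁻¹ - 2) * m) ^ (1 - v) := by
      rw [← Real.rpow_add_one hm0.ne', ← Real.rpow_mul hm0.le]
      congr 1; field_simp; ring
    rw [h1, ← Real.mul_rpow (by positivity) (by positivity),
      Real.mul_rpow two_pos.le hm0.le]
    congr 1; ring

/-- The **Hausdorff–Young inequality** with a non-sharp constant, for pairs of functions related
by the distributional Fourier transform. -/
theorem hausdorff_young {v : ℝ} (hv : 1 / 2 ≤ v) (hv1 : v ≤ 1) :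
    ∃ C : ℝ≥0∞, C ≠ ∞ ∧ ∀ F g : E → ℂ, MemLp F (recipExp v) → LocallyIntegrable g →
      (∀ ψ : 𝓢(E, ℂ), ∫ x, F x * 𝓕 ψ x = ∫ x, g x * ψ x) →
      eLpNorm g (recipExp (1 - v)) ≤ C * eLpNorm F (recipExp v) := by
  rcases hv.eq_or_lt with rfl | hv
  · refine ⟨1, by simp, fun F g hF hg hFg => ?_⟩
    norm_num only [recipExp_half] at hF ⊢
    obtain ⟨g₁, g₂, hgg, hg₁, -, -, hg₂⟩ := exists_ae_eq_add_of_fourier_pair hg hFg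
      (zero_add F).symm MemLp.zero hF
    have : g =ᵐ[volume] g₂ := by
      filter_upwards [hgg] with x hx
      have := hg₁ x
      simp only [eLpNorm_zero, nonpos_iff_eq_zero, enorm_eq_zero] at this
      simp [hx, this]
    rw [eLpNorm_congr_ae this, hg₂, one_mul]
  rcases hv1.eq_or_lt with rfl | hv1
  · refine ⟨1, by simp, fun F g hF hg hFg => ?_⟩
    rw [recipExp_one] at hF
    rw [sub_self, recipExp_zero, recipExp_one, one_mul]
    obtain ⟨g₁, g₂, hgg, hg₁, -, hg₂m, hg₂⟩ := exists_ae_eq_add_of_fourier_pair hg hFg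
      (add_zero F).symm hF MemLp.zero
    rw [eLpNorm_zero, eLpNorm_eq_zero_iff hg₂m two_ne_zero] at hg₂
    refine eLpNormEssSup_le_of_ae_enorm_bound ?_
    filter_upwards [hgg, hg₂] with x hx hx2
    simpa [hx, hx2] using hg₁ x
  · exact ⟨_, ENNReal.rpow_ne_top_of_nonneg (by linarith) ENNReal.ofReal_ne_top,
      fun F g hF hg hFg => eLpNorm_le_of_fourier_pair_of_lt hv hv1 hF hg hFg⟩

/-- Fourier inversion: if `g` is the transform of `F`, then `F (-x)` is the transform of `g`. -/
lemma fourier_pair_symm {F g : E → ℂ} (hFg : ∀ ψ : 𝓢(E, ℂ), ∫ x, F x * 𝓕 ψ x = ∫ x, g x * ψ x)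
    (ψ : 𝓢(E, ℂ)) : ∫ x, g x * 𝓕 ψ x = ∫ x, F (-x) * ψ x := by
  rw [← hFg, ← integral_neg_eq_self]
  refine integral_congr_ae (.of_forall fun x => ?_)
  have : (𝓕 (𝓕 ψ)) (-x) = ψ x := by
    have h : 𝓕⁻ (𝓕 ψ) = ψ := FourierTransform.fourierInv_fourier_eq ψ
    conv_rhs => rw [← h]
    rw [SchwartzMap.fourierInv_coe, SchwartzMap.fourier_coe, Real.fourierInv_eq_fourier_neg]
  simp only [this]

lemma eLpNorm_comp_smul {u R : ℝ} (hu : 0 ≤ u) (hR : 0 < R) (f : E → ℂ) :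
    eLpNorm (fun x => f (R • x)) (recipExp u) =
      ENNReal.ofReal (R ^ (-(Module.finrank ℝ E * u))) * eLpNorm f (recipExp u) := by
  have hemb : MeasurableEmbedding (fun x : E => R • x) :=
    (Homeomorph.smulOfNeZero R hR.ne').measurableEmbedding
  have h := hemb.eLpNorm_map_measure (f := fun x => R • x) (g := f) (p := recipExp u)
    (μ := (volume : Measure E))
  rw [Measure.map_addHaar_smul _ hR.ne', eLpNorm_smul_measure_of_ne_zero (by positivity)] at h
  rw [show (fun x => f (R • x)) = f ∘ fun x => R • x from rfl, ← h, smul_eq_mul, one_div,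
    ENNReal.toReal_inv, recipExp_toReal hu, inv_inv, abs_of_pos (by positivity),
    ENNReal.ofReal_rpow_of_pos (by positivity)]
  congr 2
  rw [Real.inv_rpow (by positivity), ← Real.rpow_natCast, ← Real.rpow_mul hR.le,
    Real.rpow_neg hR.le]

lemma aestronglyMeasurable_comp_smul {R : ℝ} (hR : R ≠ 0) {f : E → ℂ}
    (hf : AEStronglyMeasurable f) : AEStronglyMeasurable (fun x => f (R • x)) := by
  refine hf.comp_quasiMeasurePreserving ⟨measurable_const_smul R, ?_⟩
  rw [Measure.map_addHaar_smul _ hR]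
  exact Measure.smul_absolutelyContinuous

end HausdorffYoung

/-! ### Hausdorff–Young for the transform without `2π` in the exponent -/

section IsFourierTransform

variable {n : ℕ}

local notation "𝔼" => EuclideanSpace ℝ (Fin n)

lemma fourierHat_eq_fourier (ψ : 𝔼 → ℂ) (x : 𝔼) :
    fourierHat ψ x = 𝓕 ψ ((2 * Real.pi)⁻¹ • x) := by
  rw [fourierHat, Real.fourier_eq']
  refine integral_congr_ae (.of_forall fun y => ?_)
  simp only [inner_smul_right, smul_eq_mul]
  congr 2
  push_cast
  field_simp

/-- After a dilation by `2π`, `IsFourierTransform` becomes the relation with respect to Mathlib's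
normalisation of the Fourier transform. -/
lemma IsFourierTransform.fourier_pair {f g : 𝔼 → ℂ} (h : IsFourierTransform f g) (ψ : 𝓢(𝔼, ℂ)) :
    ∫ x, (((2 * Real.pi) ^ n : ℝ) : ℂ) * f ((2 * Real.pi) • x) * 𝓕 ψ x = ∫ x, g x * ψ x := by
  have hpi : 0 < 2 * Real.pi := by positivity
  rw [← h.integral_eq]
  have := Measure.integral_comp_smul (volume : Measure 𝔼) (fun x => f x * fourierHat ψ x)
    (2 * Real.pi)
  simp only [fourierHat_eq_fourier, smul_smul, inv_mul_cancel₀ hpi.ne', one_smul,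
    finrank_euclideanSpace_fin] at this
  simp only [mul_assoc, integral_const_mul, SchwartzMap.fourier_coe, fourierHat_eq_fourier]
  rw [this, abs_of_pos (by positivity), Complex.real_smul, ← mul_assoc, ← Complex.ofReal_mul,
    mul_inv_cancel₀ (by positivity)]
  simp

lemma eLpNorm_const_mul_comp_smul {v c R : ℝ} (hv : 0 ≤ v) (hR : 0 < R) (f : 𝔼 → ℂ) :
    eLpNorm (fun x => (c : ℂ) * f (R • x)) (recipExp v) =
      ENNReal.ofReal (|c| * R ^ (-(n * v))) * eLpNorm f (recipExp v) := by
  have h := eLpNorm_const_smul (c : ℂ) (fun x => f (R • x)) (recipExp v) (volume : Measure 𝔼)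
  rw [eLpNorm_comp_smul hv hR, finrank_euclideanSpace_fin, ← mul_assoc] at h
  rw [ENNReal.ofReal_mul (abs_nonneg c), ← Real.norm_eq_abs, ← Complex.norm_real, ofReal_norm, ← h]
  rfl

lemma IsFourierTransform.hausdorff_young {v : ℝ} (hv : 1 / 2 ≤ v) (hv1 : v ≤ 1) :
    ∃ C : ℝ≥0∞, C ≠ ∞ ∧ ∀ f g : 𝔼 → ℂ, IsFourierTransform f g → MemLp f (recipExp v) →
      eLpNorm g (recipExp (1 - v)) ≤ C * eLpNorm f (recipExp v) := by
  obtain ⟨C, hC, h⟩ := _root_.hausdorff_young (E := 𝔼) hv hv1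
  have hpi : 0 < 2 * Real.pi := by positivity
  refine ⟨C * ENNReal.ofReal (|(2 * Real.pi) ^ n| * (2 * Real.pi) ^ (-(n * v))),
    ENNReal.mul_ne_top hC ENNReal.ofReal_ne_top, fun f g hfg hf => ?_⟩
  rw [mul_assoc, ← eLpNorm_const_mul_comp_smul (by linarith) hpi]
  refine h _ _ ⟨(aestronglyMeasurable_comp_smul hpi.ne' hf.1).const_mul _, ?_⟩
    (locallyIntegrable_of_forall_schwartz hfg.integrable_mul) hfg.fourier_pair
  rw [eLpNorm_const_mul_comp_smul (by linarith) hpi]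
  exact ENNReal.mul_lt_top ENNReal.ofReal_lt_top hf.2

/-- The Hausdorff–Young inequality for the inverse transform. -/
lemma IsFourierTransform.hausdorff_young_symm {v : ℝ} (hv : 1 / 2 ≤ v) (hv1 : v ≤ 1) :
    ∃ C : ℝ≥0∞, C ≠ ∞ ∧ ∀ f g : 𝔼 → ℂ, IsFourierTransform f g → MemLp g (recipExp v) →
      eLpNorm f (recipExp (1 - v)) ≤ C * eLpNorm g (recipExp v) := by
  obtain ⟨C, hC, h⟩ := _root_.hausdorff_young (E := 𝔼) hv hv1
  have hpi : 0 < 2 * Real.pi := by positivity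
  set K := |(2 * Real.pi) ^ n| * (2 * Real.pi) ^ (-(n * (1 - v))) with hK
  have hK0 : 0 < K := by positivity
  refine ⟨(ENNReal.ofReal K)⁻¹ * C, ENNReal.mul_ne_top (by simpa using hK0) hC,
    fun f g hfg hg => ?_⟩
  obtain ⟨s, hs, hfs⟩ := hfg.exists_memLp
  have hs' : recipExp s⁻¹.toReal = s := recipExp_inv_toReal (one_pos.trans_le hs)
  set F : 𝔼 → ℂ := fun x => (((2 * Real.pi) ^ n : ℝ) : ℂ) * f ((2 * Real.pi) • x) with hF
  have hFm : AEStronglyMeasurable F := (aestronglyMeasurable_comp_smul hpi.ne' hfs.1).const_mul _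
  have hFs : MemLp F s := by
    refine ⟨hFm, ?_⟩
    rw [← hs', eLpNorm_const_mul_comp_smul ENNReal.toReal_nonneg hpi, hs']
    exact ENNReal.mul_lt_top ENNReal.ofReal_lt_top hfs.2
  have hneg : MeasurePreserving (fun x : 𝔼 => -x) := Measure.measurePreserving_neg volume
  have h1 := h g (fun x => F (-x)) hg ((hFs.comp_measurePreserving hneg).locallyIntegrable hs)
    (fourier_pair_symm hfg.fourier_pair)
  rw [show (fun x => F (-x)) = F ∘ fun x => -x from rfl,
    eLpNorm_comp_measurePreserving hFm hneg, hF,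
    eLpNorm_const_mul_comp_smul (by linarith) hpi, ← hK] at h1
  rw [mul_assoc, ← ENNReal.div_eq_inv_mul]
  exact (ENNReal.le_div_iff_mul_le (by simp [hK0]) (by simp)).2 (by rwa [mul_comm])

end IsFourierTransform

/-! ### Interpolation with a weighted norm -/

section LogConvexity

lemma holderTriple_recipExp {u v : ℝ} (hu : 0 ≤ u) (hv : 0 ≤ v) :
    ENNReal.HolderTriple (recipExp u) (recipExp v) (recipExp (u + v)) :=
  ⟨by simp [recipExp, ENNReal.ofReal_add hu hv]⟩

lemma recipExp_mul_mul_ofReal {u τ : ℝ} (hτ : 0 < τ) :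
    recipExp (τ * u) * ENNReal.ofReal τ = recipExp u := by
  have h0 : ENNReal.ofReal τ ≠ 0 := by simpa using hτ
  rw [recipExp, recipExp, ENNReal.ofReal_mul hτ.le,
    ENNReal.mul_inv (Or.inl h0) (Or.inl ENNReal.ofReal_ne_top), mul_right_comm,
    ENNReal.inv_mul_cancel h0 ENNReal.ofReal_ne_top, one_mul]

/-- Log-convexity of `u ↦ ‖f‖_{L^{1/u}}`. -/
lemma eLpNorm_recipExp_le_rpow_mul_rpow {α : Type*} [MeasurableSpace α] {μ : Measure α}
    {u v τ : ℝ} (hu : 0 ≤ u) (hv : 0 ≤ v) (hτ : 0 < τ) (hτ1 : τ < 1)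
    {f : α → ℂ} (hf : AEStronglyMeasurable f μ) :
    eLpNorm f (recipExp ((1 - τ) * u + τ * v)) μ ≤
      eLpNorm f (recipExp u) μ ^ (1 - τ) * eLpNorm f (recipExp v) μ ^ τ := by
  have hτ' : 0 < 1 - τ := by linarith
  have := holderTriple_recipExp (mul_nonneg hτ'.le hu) (mul_nonneg hτ.le hv)
  have h := eLpNorm_smul_le_mul_eLpNorm (p := recipExp ((1 - τ) * u)) (q := recipExp (τ * v))
    (r := recipExp ((1 - τ) * u + τ * v)) (μ := μ)
    (f := fun x => ‖f x‖ ^ τ) (φ := fun x => ‖f x‖ ^ (1 - τ))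
    (hf.norm.aemeasurable.pow_const _).aestronglyMeasurable
    (hf.norm.aemeasurable.pow_const _).aestronglyMeasurable
  rw [eLpNorm_norm_rpow _ hτ, eLpNorm_norm_rpow _ hτ', recipExp_mul_mul_ofReal hτ,
    recipExp_mul_mul_ofReal hτ'] at h
  refine (le_of_eq ?_).trans h
  refine eLpNorm_congr_norm_ae (.of_forall fun x => ?_)
  simp only [Pi.smul_apply', smul_eq_mul]
  rw [← Real.rpow_add' (norm_nonneg _) (by norm_num), sub_add_cancel, Real.rpow_one, norm_norm]

lemma toReal_eLpNorm_pos {α : Type*} [MeasureSpace α] {f : α → ℂ} {u : ℝ}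
    (hfm : AEStronglyMeasurable f) (hf : ¬ f =ᵐ[volume] 0) (h : eLpNorm f (recipExp u) ≠ ∞) :
    0 < (eLpNorm f (recipExp u)).toReal :=
  ENNReal.toReal_pos (fun h0 => hf ((eLpNorm_eq_zero_iff hfm (recipExp_ne_zero u)).1 h0)) h

lemma logNorm_convex {α : Type*} [MeasureSpace α] {u v τ : ℝ} (hu : 0 ≤ u) (hv : 0 ≤ v)
    (hτ : 0 < τ) (hτ1 : τ < 1) {f : α → ℂ} (hf0 : ¬ f =ᵐ[volume] 0)
    (hfu : MemLp f (recipExp u)) (hfv : MemLp f (recipExp v)) :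
    MemLp f (recipExp ((1 - τ) * u + τ * v)) ∧
      logNorm ((1 - τ) * u + τ * v) f ≤ (1 - τ) * logNorm u f + τ * logNorm v f := by
  have h := eLpNorm_recipExp_le_rpow_mul_rpow hu hv hτ hτ1 hfu.1
  have htop : eLpNorm f (recipExp u) ^ (1 - τ) * eLpNorm f (recipExp v) ^ τ ≠ ∞ :=
    ENNReal.mul_ne_top (ENNReal.rpow_ne_top_of_nonneg (by linarith) hfu.2.ne)
      (ENNReal.rpow_ne_top_of_nonneg hτ.le hfv.2.ne)
  have hw := ne_top_of_le_ne_top htop h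
  refine ⟨⟨hfu.1, hw.lt_top⟩, ?_⟩
  have hNu := toReal_eLpNorm_pos hfu.1 hf0 hfu.2.ne
  have hNv := toReal_eLpNorm_pos hfu.1 hf0 hfv.2.ne
  have h3 := Real.log_le_log (toReal_eLpNorm_pos hfu.1 hf0 hw) (ENNReal.toReal_mono htop h)
  rwa [ENNReal.toReal_mul, ← ENNReal.toReal_rpow, ← ENNReal.toReal_rpow,
    Real.log_mul (by positivity) (by positivity), Real.log_rpow hNu, Real.log_rpow hNv] at h3

lemma logNorm_le_of_le_mul {α β : Type*} [MeasureSpace α] [MeasureSpace β] {u v : ℝ} {C : ℝ≥0∞}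
    (hC : C ≠ ∞) {f : α → ℂ} {g : β → ℂ} (hf0 : ¬ f =ᵐ[volume] 0) (hg0 : ¬ g =ᵐ[volume] 0)
    (hg : AEStronglyMeasurable g) (hf : MemLp f (recipExp u))
    (h : eLpNorm g (recipExp v) ≤ C * eLpNorm f (recipExp u)) :
    MemLp g (recipExp v) ∧ logNorm v g ≤ Real.log C.toReal + logNorm u f := by
  have htop := ENNReal.mul_ne_top hC hf.2.ne
  have hgv := ne_top_of_le_ne_top htop h
  refine ⟨⟨hg, hgv.lt_top⟩, ?_⟩
  have hg' := toReal_eLpNorm_pos hg hg0 hgv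
  have hf' := toReal_eLpNorm_pos hf.1 hf0 hf.2.ne
  have h1 := ENNReal.toReal_mono htop h
  rw [ENNReal.toReal_mul] at h1
  have hC' : 0 < C.toReal := pos_of_mul_pos_left (hg'.trans_le h1) hf'.le
  have := Real.log_le_log hg' h1
  rwa [Real.log_mul hC'.ne' hf'.ne'] at this

end LogConvexity

section Weighted

variable {E : Type*} [NormedAddCommGroup E] [InnerProductSpace ℝ E] [FiniteDimensional ℝ E]
  [MeasurableSpace E] [BorelSpace E]

/-- The dimension of the space, as a real number. -/
local notation "d" => (Module.finrank ℝ E : ℝ)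

lemma aestronglyMeasurable_weighted {θ : ℝ} {f : E → ℂ} (hf : AEStronglyMeasurable f) :
    AEStronglyMeasurable (fun x => ‖x‖ ^ θ • f x) := by
  have h : Measurable fun x : E => ‖x‖ ^ θ := measurable_norm.pow_const θ
  exact h.aestronglyMeasurable.smul hf

/-- The norm of `f` on the unit ball is controlled by a larger exponent, and off the unit ball by
a weighted norm, since a negative power `|x|^{-θ}` is integrable at infinity to the power given
by Hölder's inequality. -/
lemma exists_eLpNorm_le_add_weighted {θ π u v : ℝ} (hθ : 0 < θ) (hπ : 0 ≤ π) (hu : 0 ≤ u)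
    (huv : u ≤ v) (hπv : π < v) (hv : d * (v - π) < θ) :
    ∃ C : ℝ≥0∞, C ≠ ∞ ∧ ∀ f : E → ℂ, AEStronglyMeasurable f →
      eLpNorm f (recipExp v) ≤
        C * (eLpNorm f (recipExp u) + eLpNorm (fun x => ‖x‖ ^ θ • f x) (recipExp π)) := by
  set B : Set E := Metric.closedBall 0 1 with hB
  have hBm : MeasurableSet B := measurableSet_closedBall
  set w₁ : E → ℝ := B.indicator 1 with hw₁
  set w₂ : E → ℝ := Bᶜ.indicator fun x => ‖x‖ ^ (-θ) with hw₂
  have hm₁ : AEStronglyMeasurable w₁ := (measurable_one.indicator hBm).aestronglyMeasurable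
  have hm₂ : AEStronglyMeasurable w₂ :=
    ((measurable_norm.pow_const (-θ)).indicator hBm.compl).aestronglyMeasurable
  have hc₁ : eLpNorm w₁ (recipExp (v - u)) < ∞ := by
    refine (eLpNorm_indicator_const_le (1 : ℝ) (recipExp (v - u))).trans_lt ?_
    refine ENNReal.mul_lt_top (by simp) (ENNReal.rpow_lt_top_of_nonneg (by positivity) ?_)
    exact measure_closedBall_lt_top.ne
  have hδ : 0 < v - π := by linarith
  have hc₂ : eLpNorm w₂ (recipExp (v - π)) < ∞ := by
    rw [eLpNorm_lt_top_iff_lintegral_rpow_enorm_lt_top (recipExp_ne_zero _)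
      (by simp [recipExp, hπv]), recipExp_toReal hδ.le]
    have hr : (Module.finrank ℝ E : ℝ) < θ * (v - π)⁻¹ := by
      rwa [← div_eq_mul_inv, lt_div_iff₀ hδ]
    have hfin := finite_integral_one_add_norm (μ := (volume : Measure E)) hr
    refine lt_of_le_of_lt ?_ (ENNReal.mul_lt_top
      (ENNReal.ofReal_lt_top (r := 2 ^ (θ * (v - π)⁻¹))) hfin)
    rw [← lintegral_const_mul' _ _ ENNReal.ofReal_ne_top]
    refine lintegral_mono fun x => ?_
    by_cases hx : x ∈ B
    · simp [hw₂, hx, hδ]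
    · have hx1 : 1 < ‖x‖ := by simpa [hB] using hx
      have hx0 : 0 < ‖x‖ := by linarith
      rw [hw₂, Set.indicator_of_mem (by simpa using hx), Real.enorm_of_nonneg (by positivity),
        ENNReal.ofReal_rpow_of_nonneg (by positivity) (by positivity),
        ← ENNReal.ofReal_mul (by positivity), ← Real.rpow_mul hx0.le, neg_mul]
      refine ENNReal.ofReal_le_ofReal ?_
      rw [Real.rpow_neg hx0.le, Real.rpow_neg (by positivity), ← Real.inv_rpow hx0.le,
        ← Real.inv_rpow (by positivity), ← Real.mul_rpow two_pos.le (by positivity)]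
      refine Real.rpow_le_rpow (by positivity) ?_ (by positivity)
      rw [← div_eq_mul_inv, inv_le_comm₀ hx0 (by positivity), inv_div]
      linarith
  have hC := ENNReal.mul_ne_top (ENNReal.LpAddConst_lt_top (recipExp v)).ne
    (ENNReal.add_ne_top.2 ⟨hc₁.ne, hc₂.ne⟩)
  refine ⟨_, hC, fun f hf => ?_⟩
  have hFm : AEStronglyMeasurable (fun x => ‖x‖ ^ θ • f x) := aestronglyMeasurable_weighted hf
  obtain ⟨F, hF⟩ : ∃ F : E → ℂ, F = fun x => ‖x‖ ^ θ • f x := ⟨_, rfl⟩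
  rw [← hF] at hFm ⊢
  have hsplit : f = w₁ • f + w₂ • F := by
    ext x
    by_cases hx : x ∈ B
    · simp [hw₁, hw₂, hx]
    · have hx1 : 1 < ‖x‖ := by simpa [hB] using hx
      have hx0 : 0 < ‖x‖ := by linarith
      simp only [hw₁, hw₂, hF, Pi.add_apply, Pi.smul_apply', Set.indicator_of_notMem hx, zero_smul,
        Set.indicator_of_mem (show x ∈ Bᶜ from hx), smul_smul, zero_add]
      rw [← Real.rpow_add hx0, neg_add_cancel, Real.rpow_zero, one_smul]
  have h₁ : eLpNorm (w₁ • f) (recipExp v) ≤ eLpNorm w₁ (recipExp (v - u)) * eLpNorm f (recipExp u) := by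
    have := holderTriple_recipExp (sub_nonneg.2 huv) hu
    rw [sub_add_cancel] at this
    exact eLpNorm_smul_le_mul_eLpNorm hf hm₁
  have h₂ : eLpNorm (w₂ • F) (recipExp v) ≤ eLpNorm w₂ (recipExp (v - π)) * eLpNorm F (recipExp π) := by
    have := holderTriple_recipExp hδ.le hπ
    rw [sub_add_cancel] at this
    exact eLpNorm_smul_le_mul_eLpNorm hFm hm₂
  have h₃ := eLpNorm_add_le' (hm₁.smul hf) (hm₂.smul hFm) (recipExp v)
  rw [← hsplit] at h₃
  refine h₃.trans ?_
  rw [mul_assoc, add_mul]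
  refine mul_le_mul_right (add_le_add (h₁.trans ?_) (h₂.trans ?_)) _
  · exact mul_le_mul_right le_self_add _
  · exact mul_le_mul_right le_add_self _

lemma eLpNorm_weighted_comp_smul {θ π R : ℝ} (hπ : 0 ≤ π) (hR : 0 < R) (f : E → ℂ) :
    eLpNorm (fun x => ‖x‖ ^ θ • f (R • x)) (recipExp π) =
      ENNReal.ofReal (R ^ (-(θ + d * π))) * eLpNorm (fun x => ‖x‖ ^ θ • f x) (recipExp π) := by
  have h := eLpNorm_comp_smul hπ hR (fun x => ‖x‖ ^ θ • f x)
  have h2 : (fun x : E => ‖R • x‖ ^ θ • f (R • x)) =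
      R ^ θ • fun x => ‖x‖ ^ θ • f (R • x) := by
    ext x
    rw [norm_smul, Real.norm_of_nonneg hR.le, Real.mul_rpow hR.le (norm_nonneg _), mul_smul]
    rfl
  rw [h2, eLpNorm_const_smul, Real.enorm_of_nonneg (by positivity)] at h
  rw [neg_add, Real.rpow_add hR, ENNReal.ofReal_mul (by positivity), mul_assoc, ← h, ← mul_assoc,
    ← ENNReal.ofReal_mul (by positivity), ← Real.rpow_add hR]
  simp

/-- The rescaled form of `exists_eLpNorm_le_add_weighted`, applied to `x ↦ f (R x)`. -/
lemma exists_toReal_eLpNorm_le_add_weighted {θ π u v : ℝ} (hθ : 0 < θ) (hπ : 0 ≤ π) (hu : 0 ≤ u)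
    (huv : u ≤ v) (hπv : π < v) (hv : d * (v - π) < θ) :
    ∃ C : ℝ, 0 < C ∧ ∀ f : E → ℂ, AEStronglyMeasurable f → eLpNorm f (recipExp u) ≠ ∞ →
      eLpNorm (fun x => ‖x‖ ^ θ • f x) (recipExp π) ≠ ∞ → eLpNorm f (recipExp v) ≠ ∞ ∧
      ∀ R : ℝ, 0 < R → (eLpNorm f (recipExp v)).toReal ≤
        C * (R ^ (d * (v - u)) * (eLpNorm f (recipExp u)).toReal +
          R ^ (d * (v - π) - θ) * (eLpNorm (fun x => ‖x‖ ^ θ • f x) (recipExp π)).toReal) := by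
  obtain ⟨C, hC, h⟩ := exists_eLpNorm_le_add_weighted (E := E) hθ hπ hu huv hπv hv
  refine ⟨C.toReal + 1, by positivity, fun f hf hfu hfπ => ?_⟩
  have hfv : eLpNorm f (recipExp v) ≠ ∞ :=
    ne_top_of_le_ne_top (ENNReal.mul_ne_top hC (ENNReal.add_ne_top.2 ⟨hfu, hfπ⟩)) (h f hf)
  refine ⟨hfv, fun R hR => ?_⟩
  have h' := h _ (aestronglyMeasurable_comp_smul hR.ne' hf)
  rw [eLpNorm_comp_smul (by linarith) hR, eLpNorm_comp_smul hu hR,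
    eLpNorm_weighted_comp_smul hπ hR] at h'
  have h'' := ENNReal.toReal_mono (ENNReal.mul_ne_top hC (ENNReal.add_ne_top.2
    ⟨ENNReal.mul_ne_top ENNReal.ofReal_ne_top hfu, ENNReal.mul_ne_top ENNReal.ofReal_ne_top hfπ⟩)) h'
  rw [ENNReal.toReal_mul, ENNReal.toReal_mul, ENNReal.toReal_add
    (ENNReal.mul_ne_top ENNReal.ofReal_ne_top hfu) (ENNReal.mul_ne_top ENNReal.ofReal_ne_top hfπ),
    ENNReal.toReal_mul, ENNReal.toReal_mul, ENNReal.toReal_ofReal (by positivity),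
    ENNReal.toReal_ofReal (by positivity), ENNReal.toReal_ofReal (by positivity)] at h''
  set N := (eLpNorm f (recipExp v)).toReal
  set N₁ := (eLpNorm f (recipExp u)).toReal
  set N₂ := (eLpNorm (fun x => ‖x‖ ^ θ • f x) (recipExp π)).toReal
  have hN₁ : 0 ≤ N₁ := ENNReal.toReal_nonneg
  have hN₂ : 0 ≤ N₂ := ENNReal.toReal_nonneg
  calc N = R ^ (d * v) * (R ^ (-(d * v)) * N) := by
        rw [← mul_assoc, ← Real.rpow_add hR, add_neg_cancel, Real.rpow_zero, one_mul]
    _ ≤ R ^ (d * v) * (C.toReal * (R ^ (-(d * u)) * N₁ + R ^ (-(θ + d * π)) * N₂)) := by gcongr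
    _ = C.toReal * (R ^ (d * (v - u)) * N₁ + R ^ (d * (v - π) - θ) * N₂) := by
        rw [show d * (v - u) = d * v + -(d * u) by ring,
          show d * (v - π) - θ = d * v + -(θ + d * π) by ring, Real.rpow_add hR, Real.rpow_add hR]
        ring
    _ ≤ _ := by gcongr; linarith

lemma weighted_ae_ne_zero [Nontrivial E] {θ : ℝ} {f : E → ℂ} (hf : ¬ f =ᵐ[volume] 0) :
    ¬ (fun x => ‖x‖ ^ θ • f x) =ᵐ[volume] 0 := by
  intro h
  apply hf
  filter_upwards [h, compl_mem_ae_iff.2 (measure_singleton (μ := (volume : Measure E)) 0)]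
    with x hx hx0
  have : 0 < ‖x‖ := norm_pos_iff.2 hx0
  have h2 : ‖x‖ ^ θ ≠ 0 := by positivity
  simpa [h2] using hx

/-- The case `1/v < p` of `exists_logNorm_le_weighted`, where Hölder's inequality applies. -/
lemma exists_logNorm_le_weighted_of_gt [Nontrivial E] {θ π u v : ℝ} (hθ : 0 < θ) (hπ : 0 ≤ π)
    (hu : 0 ≤ u) (huv : u < v) (hπv : π < v) (hv : v < π + θ / d) :
    ∃ c : ℝ, ∀ f : E → ℂ, AEStronglyMeasurable f → ¬ f =ᵐ[volume] 0 →
      eLpNorm f (recipExp u) ≠ ∞ → eLpNorm (fun x => ‖x‖ ^ θ • f x) (recipExp π) ≠ ∞ →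
      eLpNorm f (recipExp v) ≠ ∞ ∧
      (π + θ / d - u) * logNorm v f ≤
        c + (v - u) * logNorm π (fun x => ‖x‖ ^ θ • f x) + (π + θ / d - v) * logNorm u f := by
  have hd : 0 < d := by exact_mod_cast Module.finrank_pos
  set σ := π + θ / d with hσ
  have hσθ : θ = d * (σ - π) := by rw [hσ]; field_simp; ring
  have hv' : d * (v - π) < θ := by
    rw [hσθ]; exact mul_lt_mul_of_pos_left (by linarith) hd
  obtain ⟨C, hC, h⟩ := exists_toReal_eLpNorm_le_add_weighted (E := E) hθ hπ hu huv.le hπv hv'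
  refine ⟨(σ - u) * Real.log (C * 2), fun f hfm hf0 hfu hfπ => ?_⟩
  obtain ⟨hfv, hR⟩ := h f hfm hfu hfπ
  refine ⟨hfv, ?_⟩
  have hN := toReal_eLpNorm_pos hfm hf0 hfv
  have hN₁ := toReal_eLpNorm_pos hfm hf0 hfu
  have hN₂ := toReal_eLpNorm_pos
    (aestronglyMeasurable_weighted hfm)
    (weighted_ae_ne_zero (θ := θ) hf0) hfπ
  simp only [logNorm]
  set N := (eLpNorm f (recipExp v)).toReal
  set N₁ := (eLpNorm f (recipExp u)).toReal
  set N₂ := (eLpNorm (fun x => ‖x‖ ^ θ • f x) (recipExp π)).toReal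
  have hσu : 0 < σ - u := by linarith
  -- the radius balancing the two terms of the bound
  set L := (Real.log N₂ - Real.log N₁) / (d * (σ - u)) with hL
  have h1 := hR (Real.exp L) (Real.exp_pos L)
  have e1 : Real.exp L ^ (d * (v - u)) * N₁ =
      Real.exp ((v - u) / (σ - u) * (Real.log N₂ - Real.log N₁) + Real.log N₁) := by
    rw [Real.exp_add, Real.exp_log hN₁, ← Real.exp_mul, hL]
    congr 2; field_simp
  have e2 : Real.exp L ^ (d * (v - π) - θ) * N₂ =
      Real.exp ((v - u) / (σ - u) * (Real.log N₂ - Real.log N₁) + Real.log N₁) := by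
    nth_rewrite 1 [← Real.exp_log hN₂]
    rw [← Real.exp_mul, ← Real.exp_add, hL, hσθ]
    congr 1; field_simp; ring
  rw [e1, e2, ← two_mul, ← mul_assoc] at h1
  have h2 := Real.log_le_log hN h1
  rw [Real.log_mul (by positivity) (Real.exp_pos _).ne', Real.log_exp] at h2
  have h3 := mul_le_mul_of_nonneg_left h2 hσu.le
  refine h3.trans (le_of_eq ?_)
  field_simp
  ring

/-- A finite weighted norm `‖|x|^θ f‖_{L^p}` acts in interpolation like the norm of `f` in the
space `L^s` with the same scaling, `1/s = 1/p + θ/d`, except at the endpoint `s` itself. -/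
theorem exists_logNorm_le_weighted [Nontrivial E] {θ π u v : ℝ} (hθ : 0 < θ) (hπ : 0 ≤ π)
    (hu : 0 ≤ u) (huv : u < v) (hv : v < π + θ / d) :
    ∃ c : ℝ, ∀ f : E → ℂ, AEStronglyMeasurable f → ¬ f =ᵐ[volume] 0 →
      eLpNorm f (recipExp u) ≠ ∞ → eLpNorm (fun x => ‖x‖ ^ θ • f x) (recipExp π) ≠ ∞ →
      eLpNorm f (recipExp v) ≠ ∞ ∧
      (π + θ / d - u) * logNorm v f ≤
        c + (v - u) * logNorm π (fun x => ‖x‖ ^ θ • f x) + (π + θ / d - v) * logNorm u f := by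
  have hd : 0 < d := by exact_mod_cast Module.finrank_pos
  have hθd : 0 < θ / d := by positivity
  -- `1/w` is an exponent between `s` and `min p (1/v)`; then interpolate between `1/w` and `1/u`
  obtain ⟨w, hw1, hw2⟩ := exists_between (max_lt hv (lt_add_of_pos_right π hθd))
  obtain ⟨hvw, hπw⟩ := max_lt_iff.1 hw1
  obtain ⟨c, h⟩ := exists_logNorm_le_weighted_of_gt (E := E) hθ hπ hu (huv.trans hvw) hπw hw2
  have hwu : 0 < w - u := by linarith
  set τ := (v - u) / (w - u) with hτ
  have hτ0 : 0 < τ := div_pos (by linarith) hwu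
  have hτ1 : τ < 1 := (div_lt_one hwu).2 (by linarith)
  have hvτ : v = (1 - τ) * u + τ * w := by rw [hτ]; field_simp; ring
  refine ⟨τ * c, fun f hfm hf0 hfu hfπ => ?_⟩
  obtain ⟨hfw, h1⟩ := h f hfm hf0 hfu hfπ
  obtain ⟨hfv, h3⟩ := logNorm_convex hu (hu.trans (huv.trans hvw).le) hτ0 hτ1 hf0
    ⟨hfm, hfu.lt_top⟩ ⟨hfm, hfw.lt_top⟩
  rw [← hvτ] at hfv h3
  refine ⟨hfv.2.ne, ?_⟩
  set σ := π + θ / d with hσ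
  have hσu : 0 < σ - u := by linarith
  have h4 := mul_le_mul_of_nonneg_left h3 hσu.le
  have h5 := mul_le_mul_of_nonneg_left h1 hτ0.le
  have e : v - u = τ * (w - u) := by rw [hvτ]; ring
  have e' : σ - v = (1 - τ) * (σ - u) + τ * (σ - w) := by rw [hvτ]; ring
  rw [e, e']
  linarith

end Weighted

/-! ### The weighted norm and the ratio of the norms of a function and its transform -/

section Comparison

variable {E : Type*} [NormedAddCommGroup E] [InnerProductSpace ℝ E] [FiniteDimensional ℝ E]
  [MeasurableSpace E] [BorelSpace E]

local notation "d" => (Module.finrank ℝ E : ℝ)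

/-- If the Fourier transform maps `L^{r'}` to `L^r`, `r > 2`, the weighted norm of `f` bounds the
ratio `‖g‖_r / ‖f‖_r` from above. -/
lemma exists_logNorm_sub_le_of_lt_half [Nontrivial E] {θ π u : ℝ} (hθ : 0 < θ) (hπ : 0 ≤ π)
    (hu : 0 ≤ u) (hu2 : u < 1 / 2) (hσ : 1 - u < π + θ / d) {C : ℝ≥0∞} (hC : C ≠ ∞) :
    ∃ c : ℝ, ∀ f g : E → ℂ, MemLp f (recipExp u) → MemLp g (recipExp u) → ¬ f =ᵐ[volume] 0 →
      ¬ g =ᵐ[volume] 0 → eLpNorm (fun x => ‖x‖ ^ θ • f x) (recipExp π) ≠ ∞ →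
      (MemLp f (recipExp (1 - u)) →
        eLpNorm g (recipExp u) ≤ C * eLpNorm f (recipExp (1 - u))) →
      (π + θ / d - u) * (logNorm u g - logNorm u f) ≤
        c + (1 - 2 * u) * (logNorm π (fun x => ‖x‖ ^ θ • f x) - logNorm u f) := by
  obtain ⟨c, hc⟩ := exists_logNorm_le_weighted (E := E) hθ hπ hu (by linarith) hσ
  refine ⟨(π + θ / d - u) * Real.log C.toReal + c, fun f g hf hg hf0 hg0 hfw hfg => ?_⟩
  obtain ⟨h1, h2⟩ := hc f hf.1 hf0 hf.2.ne hfw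
  obtain ⟨-, h3⟩ := logNorm_le_of_le_mul hC hf0 hg0 hg.1 ⟨hf.1, h1.lt_top⟩ (hfg ⟨hf.1, h1.lt_top⟩)
  have h4 := mul_le_mul_of_nonneg_left h3 (show 0 ≤ π + θ / d - u by linarith)
  linarith

/-- If the Fourier transform maps `L^r` to `L^{r'}`, `1 ≤ r < 2`, the weighted norm of `f` bounds
the ratio `‖f‖_r / ‖g‖_r` from above. -/
lemma exists_logNorm_sub_le_of_half_lt [Nontrivial E] {θ π u : ℝ} (hθ : 0 < θ) (hπ : 0 ≤ π)
    (hu2 : 1 / 2 < u) (hu1 : u ≤ 1) (hσ : u < π + θ / d) {C : ℝ≥0∞} (hC : C ≠ ∞) :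
    ∃ c : ℝ, ∀ f g : E → ℂ, MemLp f (recipExp u) → MemLp g (recipExp u) → ¬ f =ᵐ[volume] 0 →
      ¬ g =ᵐ[volume] 0 → eLpNorm (fun x => ‖x‖ ^ θ • f x) (recipExp π) ≠ ∞ →
      eLpNorm f (recipExp (1 - u)) ≤ C * eLpNorm g (recipExp u) →
      (π + θ / d - u) * (logNorm u f - logNorm u g) ≤
        c + (2 * u - 1) * (logNorm π (fun x => ‖x‖ ^ θ • f x) - logNorm u f) := by
  obtain ⟨c, hc⟩ := exists_logNorm_le_weighted (E := E) hθ hπ (sub_nonneg.2 hu1)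
    (by linarith) hσ
  refine ⟨(π + θ / d - u) * Real.log C.toReal + c, fun f g hf hg hf0 hg0 hfw hfg => ?_⟩
  obtain ⟨h1, h2⟩ := logNorm_le_of_le_mul hC hg0 hf0 hf.1 hg hfg
  obtain ⟨-, h3⟩ := hc f hf.1 hf0 h1.2.ne hfw
  have h4 := mul_le_mul_of_nonneg_left h2 (show 0 ≤ π + θ / d - u by linarith)
  linarith

/-- The analogue of `exists_logNorm_sub_le_of_half_lt` for `r < 1`. It uses only that the Fourier
transform and its inverse map `L¹` to `L^∞`, and log-convexity to bootstrap from `L^r`. -/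
lemma exists_logNorm_sub_le_of_one_lt [Nontrivial E] {θ π u : ℝ} (hθ : 0 < θ) (hπ : 0 ≤ π)
    (hu1 : 1 < u) (hσ : u < π + θ / d) {C C' : ℝ≥0∞} (hC : C ≠ ∞) (hC' : C' ≠ ∞) :
    ∃ c : ℝ, ∀ f g : E → ℂ, MemLp f (recipExp u) → MemLp g (recipExp u) → ¬ f =ᵐ[volume] 0 →
      ¬ g =ᵐ[volume] 0 → eLpNorm (fun x => ‖x‖ ^ θ • f x) (recipExp π) ≠ ∞ →
      MemLp f (recipExp 0) → MemLp g (recipExp 0) →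
      (MemLp f (recipExp 1) → eLpNorm g (recipExp 0) ≤ C * eLpNorm f (recipExp 1)) →
      (MemLp g (recipExp 1) → eLpNorm f (recipExp 0) ≤ C' * eLpNorm g (recipExp 1)) →
      (π + θ / d - u) * (logNorm u f - logNorm u g) ≤
        c + (2 * u - 1) * (logNorm π (fun x => ‖x‖ ^ θ • f x) - logNorm u f) := by
  have hu0 : 0 < u := by linarith
  have hw1 : u⁻¹ < 1 := inv_lt_one_of_one_lt₀ hu1
  have hone : (1 - u⁻¹) * 0 + u⁻¹ * u = 1 := by field_simp; ring
  obtain ⟨c, hc⟩ := exists_logNorm_le_weighted (E := E) hθ hπ le_rfl hu0 hσ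
  set σ := π + θ / d with hσdef
  set k := Real.log C.toReal
  set k' := Real.log C'.toReal
  refine ⟨((2 * u - 1) * c + (σ - u) * (u * k' + (u - 1) * k) * u) / u,
    fun f g hf hg hf0 hg0 hfw hfb hgb hfg hgf => ?_⟩
  obtain ⟨-, h1⟩ := hc f hf.1 hf0 hfb.2.ne hfw
  obtain ⟨hf1, h2⟩ := logNorm_convex le_rfl hu0.le (inv_pos.2 hu0) hw1 hf0 hfb hf
  obtain ⟨hg1, h3⟩ := logNorm_convex le_rfl hu0.le (inv_pos.2 hu0) hw1 hg0 hgb hg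
  rw [hone] at hf1 h2 hg1 h3
  obtain ⟨-, h4⟩ := logNorm_le_of_le_mul hC hf0 hg0 hg.1 hf1 (hfg hf1)
  obtain ⟨-, h5⟩ := logNorm_le_of_le_mul hC' hg0 hf0 hf.1 hg1 (hgf hg1)
  -- clear the denominators in the two interpolation inequalities
  have h2' : u * logNorm 1 f ≤ (u - 1) * logNorm 0 f + logNorm u f := by
    have := mul_le_mul_of_nonneg_left h2 hu0.le
    field_simp at this
    linarith
  have h3' : u * logNorm 1 g ≤ (u - 1) * logNorm 0 g + logNorm u g := by
    have := mul_le_mul_of_nonneg_left h3 hu0.le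
    field_simp at this
    linarith
  have h6 : u * logNorm 0 f ≤ u * k' + (u - 1) * logNorm 0 g + logNorm u g := by
    have := mul_le_mul_of_nonneg_left h5 hu0.le
    linarith
  have h7 : u * logNorm 0 g ≤ u * k + (u - 1) * logNorm 0 f + logNorm u f := by
    have := mul_le_mul_of_nonneg_left h4 hu0.le
    linarith
  have h8 : (2 * u - 1) * logNorm 0 f ≤
      u * (u * k' + (u - 1) * k) + u * logNorm u g + (u - 1) * logNorm u f := by
    have h9 := mul_le_mul_of_nonneg_left h6 hu0.le
    have h10 := mul_le_mul_of_nonneg_left h7 (show 0 ≤ u - 1 by linarith)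
    linarith
  have h11 := mul_le_mul_of_nonneg_left h8 (show 0 ≤ σ - u by linarith)
  have h12 := mul_le_mul_of_nonneg_left h1 (show 0 ≤ 2 * u - 1 by linarith)
  rw [div_add' _ _ _ hu0.ne', le_div_iff₀ hu0]
  linarith

end Comparison

/-! ### The uncertainty inequality -/

section Uncertainty

variable {n : ℕ}

local notation "𝔼" => EuclideanSpace ℝ (Fin n)

lemma IsFourierTransform.ae_eq_zero {f g : 𝔼 → ℂ} (h : IsFourierTransform f g)
    (hg : g =ᵐ[volume] 0) : f =ᵐ[volume] 0 := by
  obtain ⟨C, -, hC⟩ := IsFourierTransform.hausdorff_young_symm (n := n) (v := 1 / 2) le_rfl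
    (by norm_num)
  have h1 := hC f g h ((memLp_congr_ae hg).2 MemLp.zero)
  obtain ⟨s, -, hs⟩ := h.exists_memLp
  rwa [eLpNorm_congr_ae hg, eLpNorm_zero, mul_zero, nonpos_iff_eq_zero,
    eLpNorm_eq_zero_iff hs.1 (recipExp_ne_zero _)] at h1

lemma memLp_recipExp_of_le_of_le {α : Type*} [MeasureSpace α] {u v w : ℝ} (hu : 0 ≤ u)
    (huw : u ≤ w) (hwv : w ≤ v) {f : α → ℂ} (hfu : MemLp f (recipExp u))
    (hfv : MemLp f (recipExp v)) : MemLp f (recipExp w) := by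
  rcases huw.eq_or_lt with rfl | huw
  · exact hfu
  rcases hwv.eq_or_lt with rfl | hwv
  · exact hfv
  have hd : 0 < v - u := by linarith
  have hτ : w = (1 - (w - u) / (v - u)) * u + (w - u) / (v - u) * v := by field_simp; ring
  refine ⟨hfu.1, ?_⟩
  rw [hτ]
  refine (eLpNorm_recipExp_le_rpow_mul_rpow hu (by linarith) (div_pos (by linarith) hd)
    ((div_lt_one hd).2 (by linarith)) hfu.1).trans_lt (ENNReal.mul_lt_top ?_ ?_)
  · exact ENNReal.rpow_lt_top_of_nonneg
      (sub_nonneg.2 ((div_le_one hd).2 (by linarith))) hfu.2.ne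
  · exact ENNReal.rpow_lt_top_of_nonneg (div_nonneg (by linarith) hd.le) hfv.2.ne

/-- Opposite bounds for the ratio of the norms of `f` and of its transform combine to the
uncertainty inequality. -/
lemma add_nonneg_of_mul_le {a b δ c c' D X Y : ℝ} (ha : 0 < a) (hb : 0 < b) (hδ : 0 < δ)
    (h : a * D ≤ c + δ * X) (h' : b * -D ≤ c' + δ * Y) :
    0 ≤ (b * c + a * c') / δ + b * X + a * Y := by
  have h1 := mul_le_mul_of_nonneg_left h hb.le
  have h2 := mul_le_mul_of_nonneg_left h' ha.le
  have : 0 ≤ (b * c + a * c' + δ * (b * X + a * Y)) / δ := div_nonneg (by linarith) hδ.le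
  rwa [add_div, mul_div_cancel_left₀ _ hδ.ne', ← add_assoc] at this

/-- The uncertainty inequality in logarithmic form. -/
theorem exists_logNorm_uncertainty (hn : 0 < n) {θ φ π ρ u : ℝ} (hθ : 0 < θ) (hφ : 0 < φ)
    (hπ : 0 ≤ π) (hρ : 0 ≤ ρ) (hu : 0 ≤ u)
    (hσu : u < π + θ / n) (hσu' : 1 - u < π + θ / n) (hτu : u < ρ + φ / n) (hτu' : 1 - u < ρ + φ / n) :
    ∃ c : ℝ, ∀ f g : 𝔼 → ℂ, MemLp f (recipExp u) → MemLp g (recipExp u) →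
      IsFourierTransform f g → ¬ f =ᵐ[volume] 0 → ¬ g =ᵐ[volume] 0 →
      eLpNorm (fun x => ‖x‖ ^ θ • f x) (recipExp π) ≠ ∞ →
      eLpNorm (fun x => ‖x‖ ^ φ • g x) (recipExp ρ) ≠ ∞ →
      0 ≤ c + (ρ + φ / n - u) * (logNorm π (fun x => ‖x‖ ^ θ • f x) - logNorm u f) +
        (π + θ / n - u) * (logNorm ρ (fun x => ‖x‖ ^ φ • g x) - logNorm u g) := by
  have : NeZero n := ⟨hn.ne'⟩
  have hd : ((Module.finrank ℝ 𝔼 : ℕ) : ℝ) = n := by simp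
  have ha : 0 < π + θ / n - u := by linarith
  have hb : 0 < ρ + φ / n - u := by linarith
  rw [← hd] at hσu hσu' hτu hτu' ha hb ⊢
  set σ := π + θ / (Module.finrank ℝ 𝔼) with hσ
  set τ := ρ + φ / (Module.finrank ℝ 𝔼) with hτ
  rcases lt_trichotomy u (1 / 2) with hu2 | rfl | hu2
  · obtain ⟨C, hC, hfg⟩ := IsFourierTransform.hausdorff_young (n := n) (v := 1 - u)
      (by linarith) (by linarith)
    obtain ⟨C', hC', hgf⟩ := IsFourierTransform.hausdorff_young_symm (n := n) (v := 1 - u)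
      (by linarith) (by linarith)
    rw [sub_sub_cancel] at hfg hgf
    obtain ⟨c, hc⟩ := exists_logNorm_sub_le_of_lt_half (E := 𝔼) hθ hπ hu hu2 hσu' hC
    obtain ⟨c', hc'⟩ := exists_logNorm_sub_le_of_lt_half (E := 𝔼) hφ hρ hu hu2 hτu' hC'
    refine ⟨((τ - u) * c + (σ - u) * c') / (1 - 2 * u),
      fun f g hf hg h hf0 hg0 hfw hgw => ?_⟩
    have h1 := hc f g hf hg hf0 hg0 hfw (hfg f g h)
    have h2 := hc' g f hg hf hg0 hf0 hgw (hgf f g h)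
    rw [← neg_sub (logNorm u g)] at h2
    exact add_nonneg_of_mul_le ha hb (by linarith) h1 h2
  -- `‖g‖_{1/(1-v)} ≤ C ‖f‖_{1/v}` for some `v > 1/2`, and `‖f‖₂` is comparable with `‖g‖₂`
  · obtain ⟨v, hv, hv'⟩ := exists_between (lt_min one_half_lt_one hσu)
    obtain ⟨hv1, hvσ⟩ := lt_min_iff.1 hv'
    obtain ⟨C, hC, hfg⟩ := IsFourierTransform.hausdorff_young (n := n) hv.le hv1.le
    obtain ⟨C', hC', hgf⟩ := IsFourierTransform.hausdorff_young_symm (n := n) (v := 1 / 2) le_rfl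
      (by norm_num)
    obtain ⟨c, hc⟩ := exists_logNorm_le_weighted (E := 𝔼) hθ hπ hu hv hvσ
    obtain ⟨c', hc'⟩ := exists_logNorm_le_weighted (E := 𝔼) hφ hρ (sub_nonneg.2 hv1.le)
      (show 1 - v < 1 / 2 by linarith) hτu
    set k := Real.log C.toReal
    set k' := Real.log C'.toReal
    refine ⟨((σ - 1 / 2) * c' + (τ - 1 / 2) * c + (σ - 1 / 2) * (τ - 1 / 2) * (k + k')) / (v - 1 / 2),
      fun f g hf hg h hf0 hg0 hfw hgw => ?_⟩
    obtain ⟨h1, h2⟩ := hc f hf.1 hf0 hf.2.ne hfw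
    have hfv : MemLp f (recipExp v) := ⟨hf.1, h1.lt_top⟩
    obtain ⟨hgv, h3⟩ := logNorm_le_of_le_mul hC hf0 hg0 hg.1 hfv (hfg f g h hfv)
    obtain ⟨-, h4⟩ := hc' g hg.1 hg0 hgv.2.ne hgw
    have h5 := hgf f g h hg
    norm_num only at h5
    obtain ⟨-, h6⟩ := logNorm_le_of_le_mul hC' hg0 hf0 hf.1 hg h5
    set X := logNorm π (fun x => ‖x‖ ^ θ • f x)
    set Y := logNorm ρ (fun x => ‖x‖ ^ φ • g x)
    have hab : 0 < (σ - 1 / 2) * (τ - 1 / 2) := mul_pos ha hb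
    have h7 := mul_le_mul_of_nonneg_left h6 hab.le
    have h8 := mul_le_mul_of_nonneg_left h4 ha.le
    have h9 := mul_le_mul_of_nonneg_left h3 hab.le
    have h10 := mul_le_mul_of_nonneg_left h2 hb.le
    have hv0 : 0 < v - 1 / 2 := by linarith
    rw [div_add' _ _ _ hv0.ne', div_add' _ _ _ hv0.ne']
    refine div_nonneg ?_ hv0.le
    linarith
  rcases le_or_gt u 1 with hu1 | hu1
  · obtain ⟨C, hC, hfg⟩ := IsFourierTransform.hausdorff_young (n := n) hu2.le hu1
    obtain ⟨C', hC', hgf⟩ := IsFourierTransform.hausdorff_young_symm (n := n) hu2.le hu1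
    obtain ⟨c, hc⟩ := exists_logNorm_sub_le_of_half_lt (E := 𝔼) hθ hπ hu2 hu1 hσu hC'
    obtain ⟨c', hc'⟩ := exists_logNorm_sub_le_of_half_lt (E := 𝔼) hφ hρ hu2 hu1 hτu hC
    refine ⟨((τ - u) * c + (σ - u) * c') / (2 * u - 1),
      fun f g hf hg h hf0 hg0 hfw hgw => ?_⟩
    have h1 := hc f g hf hg hf0 hg0 hfw (hgf f g h hg)
    have h2 := hc' g f hg hf hg0 hf0 hgw (hfg f g h hf)
    rw [← neg_sub (logNorm u f)] at h2
    exact add_nonneg_of_mul_le ha hb (by linarith) h1 h2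
  · obtain ⟨C, hC, hfg⟩ := IsFourierTransform.hausdorff_young (n := n) (v := 1)
      (by norm_num) le_rfl
    obtain ⟨C', hC', hgf⟩ := IsFourierTransform.hausdorff_young_symm (n := n) (v := 1)
      (by norm_num) le_rfl
    rw [sub_self] at hfg hgf
    obtain ⟨c, hc⟩ := exists_logNorm_sub_le_of_one_lt (E := 𝔼) hθ hπ hu1 hσu hC hC'
    obtain ⟨c', hc'⟩ := exists_logNorm_sub_le_of_one_lt (E := 𝔼) hφ hρ hu1 hτu hC' hC
    refine ⟨((τ - u) * c + (σ - u) * c') / (2 * u - 1),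
      fun f g hf hg h hf0 hg0 hfw hgw => ?_⟩
    obtain ⟨s, hs, hfs⟩ := h.exists_memLp
    -- `f ∈ L^r ∩ L^s` with `r < 1 ≤ s`, hence `f ∈ L¹` and `g ∈ L^∞`; then `g ∈ L¹` and `f ∈ L^∞`
    have hf1 : MemLp f (recipExp 1) := by
      rw [← recipExp_inv_toReal (one_pos.trans_le hs)] at hfs
      refine memLp_recipExp_of_le_of_le ENNReal.toReal_nonneg ?_ hu1.le hfs hf
      exact ENNReal.toReal_le_of_le_ofReal zero_le_one (by simpa using hs)
    have hgb : MemLp g (recipExp 0) :=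
      ⟨hg.1, (hfg f g h hf1).trans_lt (ENNReal.mul_lt_top hC.lt_top hf1.2)⟩
    have hg1 : MemLp g (recipExp 1) :=
      memLp_recipExp_of_le_of_le le_rfl zero_le_one hu1.le hgb hg
    have hfb : MemLp f (recipExp 0) :=
      ⟨hf.1, (hgf f g h hg1).trans_lt (ENNReal.mul_lt_top hC'.lt_top hg1.2)⟩
    have h1 := hc f g hf hg hf0 hg0 hfw hfb hgb (hfg f g h) (hgf f g h)
    have h2 := hc' g f hg hf hg0 hf0 hgw hgb hfb (hgf f g h) (hfg f g h)
    rw [← neg_sub (logNorm u f)] at h2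
    exact add_nonneg_of_mul_le ha hb (by linarith) h1 h2

/-- The assumption `r < s'` for `s ≥ 1`, in terms of `u = 1/r` and `1/s = 1/p + θ/n`. -/
lemma one_sub_lt_of_lt_conjExponent (hn : 0 < n) {θ : ℝ} (hθ : 0 < θ) {p r : ℝ≥0∞} (hr : 0 < r)
    (h : 1 ≤ critExponent n p θ → r < (critExponent n p θ).conjExponent) :
    1 - r⁻¹.toReal < p⁻¹.toReal + θ / n := by
  have hn' : (0 : ℝ) < n := by exact_mod_cast hn
  have hσ : 0 < p⁻¹.toReal + θ / n := by
    have := ENNReal.toReal_nonneg (a := p⁻¹)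
    positivity
  have hcrit : critExponent n p θ = recipExp (p⁻¹.toReal + θ / n) := by
    rw [recipExp_of_pos hσ, critExponent]
    congr 1
    field_simp
  have hr0 : 0 ≤ r⁻¹.toReal := ENNReal.toReal_nonneg
  rw [hcrit] at h
  by_contra! hle
  have hs : 1 ≤ recipExp (p⁻¹.toReal + θ / n) := one_le_recipExp (by linarith)
  have h1 := ENNReal.inv_lt_inv.2 (h hs)
  have h2 := (ENNReal.HolderConjugate.conjExponent hs).inv_add_inv_eq_one
  rw [recipExp, inv_inv, ← recipExp] at h2
  have h3 := ENNReal.add_lt_add_left (a := ENNReal.ofReal (p⁻¹.toReal + θ / n))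
    ENNReal.ofReal_ne_top h1
  rw [h2, ← ENNReal.ofReal_toReal (show r⁻¹ ≠ ∞ by simpa using hr.ne'),
    ← ENNReal.ofReal_add hσ.le hr0, ← ENNReal.ofReal_one,
    ENNReal.ofReal_lt_ofReal_iff_of_nonneg zero_le_one] at h3
  linarith

lemma toReal_inv_lt_of_toReal_inv_min {x y : ℝ} {r : ℝ≥0∞} (hr : 0 < r)
    (h : ((min 2 r)⁻¹).toReal - x < y) : r⁻¹.toReal < x + y := by
  have hm : (min 2 r)⁻¹ ≠ ∞ := by simp [hr.ne']
  have h2 := ENNReal.toReal_mono hm (ENNReal.inv_le_inv.2 (min_le_right 2 r))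
  linarith

lemma div_rpow_eq_ofReal_exp {x : ℝ≥0∞} {y : ℝ≥0∞} {a : ℝ} (hx : x ≠ ∞) (hy : y ≠ ∞)
    (hx0 : 0 < x.toReal) (hy0 : 0 < y.toReal) :
    (x / y) ^ a = ENNReal.ofReal (Real.exp (a * (Real.log x.toReal - Real.log y.toReal))) := by
  rw [← ENNReal.ofReal_toReal hx, ← ENNReal.ofReal_toReal hy, ← ENNReal.ofReal_div_of_pos hy0,
    ENNReal.ofReal_rpow_of_pos (by positivity), ENNReal.toReal_ofReal hx0.le,
    ENNReal.toReal_ofReal hy0.le, Real.rpow_def_of_pos (by positivity),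
    Real.log_div hx0.ne' hy0.ne', mul_comm]

end Uncertainty

theorem corollary2 (n : ℕ) (hn : 0 < n) (θ φ : ℝ) (hθ : 0 < θ) (hφ : 0 < φ)
    (p q r : ℝ≥0∞) (hp : 0 < p) (hq : 0 < q) (hr : 0 < r)
    (h₁θ : ((min 2 r)⁻¹).toReal - p⁻¹.toReal < θ / n)
    (h₁φ : ((min 2 r)⁻¹).toReal - q⁻¹.toReal < φ / n)
    (h₂ : 1 ≤ critExponent n p θ → r < (critExponent n p θ).conjExponent)
    (h₃ : 1 ≤ critExponent n q φ → r < (critExponent n q φ).conjExponent) :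
    ∃ C : ℝ, 0 < C ∧ ∀ f fhat : EuclideanSpace ℝ (Fin n) → ℂ,
      MemLp f r volume → MemLp fhat r volume → IsFourierTransform f fhat →
      ¬ (f =ᵐ[volume] 0) →
      ENNReal.ofReal C ≤
        (eLpNorm (fun x => ‖x‖ ^ θ • f x) p volume / eLpNorm f r volume) ^
            (φ - n * (r⁻¹.toReal - q⁻¹.toReal)) *
          (eLpNorm (fun ξ => ‖ξ‖ ^ φ • fhat ξ) q volume / eLpNorm fhat r volume) ^
            (θ - n * (r⁻¹.toReal - p⁻¹.toReal)) := by
  have : NeZero n := ⟨hn.ne'⟩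
  have hn' : (0 : ℝ) < n := by exact_mod_cast hn
  have hσu := toReal_inv_lt_of_toReal_inv_min hr h₁θ
  have hτu := toReal_inv_lt_of_toReal_inv_min hr h₁φ
  have hσu' := one_sub_lt_of_lt_conjExponent hn hθ hr h₂
  have hτu' := one_sub_lt_of_lt_conjExponent hn hφ hr h₃
  obtain ⟨c, hc⟩ := exists_logNorm_uncertainty hn hθ hφ ENNReal.toReal_nonneg
    ENNReal.toReal_nonneg ENNReal.toReal_nonneg hσu hσu' hτu hτu'
  simp only [logNorm, recipExp_inv_toReal hp, recipExp_inv_toReal hq, recipExp_inv_toReal hr] at hc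
  have hA : φ - n * (r⁻¹.toReal - q⁻¹.toReal) = n * (q⁻¹.toReal + φ / n - r⁻¹.toReal) := by
    field_simp; ring
  have hB : θ - n * (r⁻¹.toReal - p⁻¹.toReal) = n * (p⁻¹.toReal + θ / n - r⁻¹.toReal) := by
    field_simp; ring
  have hA0 := mul_pos hn' (sub_pos.2 hτu)
  have hB0 := mul_pos hn' (sub_pos.2 hσu)
  rw [← hA] at hA0
  rw [← hB] at hB0
  refine ⟨Real.exp (-(n * c)), Real.exp_pos _, fun f g hf hg h hf0 => ?_⟩
  have hg0 : ¬ g =ᵐ[volume] 0 := fun h0 => hf0 (h.ae_eq_zero h0)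
  have hFm : AEStronglyMeasurable (fun x => ‖x‖ ^ θ • f x) := aestronglyMeasurable_weighted hf.1
  have hGm : AEStronglyMeasurable (fun x => ‖x‖ ^ φ • g x) := aestronglyMeasurable_weighted hg.1
  have hF0 : eLpNorm (fun x => ‖x‖ ^ θ • f x) p ≠ 0 := fun h0 =>
    weighted_ae_ne_zero hf0 ((eLpNorm_eq_zero_iff hFm hp.ne').1 h0)
  have hG0 : eLpNorm (fun x => ‖x‖ ^ φ • g x) q ≠ 0 := fun h0 =>
    weighted_ae_ne_zero hg0 ((eLpNorm_eq_zero_iff hGm hq.ne').1 h0)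
  have hf0' : eLpNorm f r ≠ 0 := fun h0 => hf0 ((eLpNorm_eq_zero_iff hf.1 hr.ne').1 h0)
  have hg0' : eLpNorm g r ≠ 0 := fun h0 => hg0 ((eLpNorm_eq_zero_iff hg.1 hr.ne').1 h0)
  have hc' := hc f g hf hg h hf0 hg0
  generalize eLpNorm (fun x => ‖x‖ ^ θ • f x) p volume = F at *
  generalize eLpNorm (fun x => ‖x‖ ^ φ • g x) q volume = G at *
  have hne : ∀ {x y : ℝ≥0∞} {a : ℝ}, 0 < a → x ≠ 0 → y ≠ ∞ → (x / y) ^ a ≠ 0 :=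
    fun ha hx hy => by simp [ENNReal.rpow_eq_zero_iff, ENNReal.div_eq_zero_iff, hx, hy, ha, ha.not_gt]
  -- if a weighted norm is infinite, so is the product, the other factor being nonzero
  rcases eq_or_ne F ∞ with rfl | hF
  · rw [ENNReal.top_div_of_ne_top hf.2.ne, ENNReal.top_rpow_of_pos hA0,
      ENNReal.top_mul (hne hB0 hG0 hg.2.ne)]
    exact le_top
  rcases eq_or_ne G ∞ with rfl | hG
  · rw [ENNReal.top_div_of_ne_top hg.2.ne, ENNReal.top_rpow_of_pos hB0,
      ENNReal.mul_top (hne hA0 hF0 hf.2.ne)]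
    exact le_top
  have h1 := hc' hF hG
  rw [div_rpow_eq_ofReal_exp hF hf.2.ne (ENNReal.toReal_pos hF0 hF)
    (ENNReal.toReal_pos hf0' hf.2.ne), div_rpow_eq_ofReal_exp hG hg.2.ne (ENNReal.toReal_pos hG0 hG)
    (ENNReal.toReal_pos hg0' hg.2.ne), ← ENNReal.ofReal_mul (Real.exp_pos _).le, ← Real.exp_add]
  refine ENNReal.ofReal_le_ofReal (Real.exp_le_exp.2 ?_)
  rw [hA, hB]
  have h2 := mul_nonneg hn'.le h1
  linarith
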